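/- Let $K$ be an algebraically closed field of characteristic $0$, and let $N\ge 1$, $d\ge 2$ be integers. Let $\mathrm{Hom}_d^N$ be the set of degree $d$ endomorphisms $f=[f_0,\dots,f_N]$ of $\mathbb P^N$ over $K$ (the $f_i$ homogeneous of degree $d$ with no common zero in $\mathbb P^N$), with its Zariski topology in the coefficients, and let $\mathcal M_d^N=\mathrm{Hom}_d^N/\mathrm{PGL}_{N+1}$ be the set of conjugacy classes under $f^\alpha=\alpha^{-1}\circ f\circ\alpha$. For a fixed point $P$ of $f$ let $\gamma_{f,P}(t)$ be the characteristic polynomial of $df_P$, i.e. of the Jacobian matrix at $P$ of $f$ written in an affine chart containing $P$. Put $$\Sigma_1(f)=\prod_{P}\bigl(w-\gamma_{f,P}(t)\bigr)\in K[t][w],$$ the product over the fixed points of $f$ counted with multiplicity (the dimension of the local ring of the fixed point scheme at $P$). The fixed-point multiplier map $\tau_{d,1}^N$ sends $f$ to the family of coefficients of $\Sigma_1(f)$, which depends only on the class of $f$ in $\mathcal M_d^N$. A triangular polynomial endomorphism of degree $d$ of $\mathbb P^N$ is an element of $\mathrm{Hom}_d^N$ which is the homogenization $[x_0^d, F_1,\dots,F_N]$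 of a polynomial map $(F_1(x_1),F_2(x_1,x_2),\dots,F_N(x_1,\dots,x_N))$ of $\mathbb A^N$. Let $T\subset \mathrm{Hom}_d^N$ be the set of these maps. Theorem. The map $\tau_{d,1}^N$ is generically finite-to-one when restricted to triangular polynomial endomorphisms: there is a Zariski-open set $U$ such that $U\cap T$ is dense in $T$ and, for every $f\in U\cap T$, there are only finitely many conjugacy classes in $\mathcal M_d^N$ that contain some $g\in T$ with $\tau_{d,1}^N(g)=\tau_{d,1}^N(f)$. -/

import Mathlib

namespace ProjDyn

open Polynomial
open scoped LinearAlgebra.Projectivization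

/-- Degree `d` endomorphisms of `ℙ^N` over an algebraically closed field, presented by a tuple
of `N + 1` homogeneous polynomials of degree `d` with no common zero other than the origin. -/
@[ext]
structure Endo (K : Type*) [Field K] (N d : ℕ) where
  poly : Fin (N + 1) → MvPolynomial (Fin (N + 1)) K
  homogeneous : ∀ i, (poly i).IsHomogeneous d
  eq_zero_of_eval : ∀ v : Fin (N + 1) → K, (∀ i, MvPolynomial.eval v (poly i) = 0) → v = 0

variable {K : Type*} [Field K] {N d : ℕ}

namespace Endo

/-- The action of the tuple on `K^(N+1)`. -/
noncomputable def toFun (f : Endo K N d) (v : Fin (N + 1) → K) : Fin (N + 1) → K :=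
  fun i => MvPolynomial.eval v (f.poly i)

/-- `g` is conjugate to `f`: up to a nonzero scalar (tuples that differ by a scalar are the same
map of `ℙ^N`), `g = A⁻¹ ∘ f ∘ A` for an invertible linear change of coordinates `A`. -/
def IsConj (f g : Endo K N d) : Prop :=
  ∃ (A : GL (Fin (N + 1)) K) (c : Kˣ), ∀ v : Fin (N + 1) → K,
    g.toFun v = (c : K) • ((A⁻¹ : GL (Fin (N + 1)) K).val.mulVec (f.toFun (A.val.mulVec v)))

theorem isConj_equivalence : Equivalence (IsConj (K := K) (N := N) (d := d)) where
  refl f := ⟨1, 1, fun v => by simp⟩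
  symm := by
    rintro f g ⟨A, c, h⟩
    refine ⟨A⁻¹, c⁻¹, fun v => ?_⟩
    rw [h]
    simp [Matrix.mulVec_smul, Matrix.mulVec_mulVec, smul_smul, ← Units.val_mul,
      -Matrix.coe_units_inv]
  trans := by
    rintro f g k ⟨A, a, h⟩ ⟨B, b, h'⟩
    refine ⟨A * B, b * a, fun v => ?_⟩
    rw [h', h]
    simp [Matrix.mulVec_smul, Matrix.mulVec_mulVec, smul_smul, -Matrix.coe_units_inv]

/-- The conjugation relation on degree `d` endomorphisms of `ℙ^N`. -/
def conjSetoid (K : Type*) [Field K] (N d : ℕ) : Setoid (Endo K N d) :=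
  ⟨IsConj, isConj_equivalence⟩

/-- The Zariski topology: a basis is given by the non-vanishing loci of polynomials in the
coefficients of `f`. -/
instance zariskiTopology : TopologicalSpace (Endo K N d) :=
  TopologicalSpace.generateFrom
    {U | ∃ Φ : MvPolynomial (Fin (N + 1) × (Fin (N + 1) →₀ ℕ)) K,
      U = {f | MvPolynomial.eval (fun p => (f.poly p.1).coeff p.2) Φ ≠ 0}}

/-- The fixed points of `f` in `ℙ^N`. -/
def fixedPoints (f : Endo K N d) : Set (ℙ K (Fin (N + 1) → K)) :=
  {P | ∃ c : K, f.toFun P.rep = c • P.rep}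

end Endo

theorem exists_rep_ne_zero (P : ℙ K (Fin (N + 1) → K)) : ∃ i, P.rep i ≠ 0 :=
  Function.ne_iff.mp P.rep_nonzero

open Classical in
/-- The index of the first nonzero homogeneous coordinate of `P`; it selects an affine chart
containing `P`. -/
noncomputable def chart (P : ℙ K (Fin (N + 1) → K)) : Fin (N + 1) :=
  Fin.find (fun i => P.rep i ≠ 0) (exists_rep_ne_zero P)

/-- The homogeneous coordinates of `P`, scaled such that the coordinate `chart P` is `1`. -/
noncomputable def coords (P : ℙ K (Fin (N + 1) → K)) : Fin (N + 1) → K :=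
  (P.rep (chart P))⁻¹ • P.rep

/-- The maximal ideal of the polynomials that vanish at the point `v`. -/
noncomputable def pointIdeal (v : Fin (N + 1) → K) : Ideal (MvPolynomial (Fin (N + 1)) K) :=
  RingHom.ker (MvPolynomial.eval v)

instance pointIdeal_isPrime (v : Fin (N + 1) → K) : (pointIdeal v).IsPrime :=
  RingHom.ker_isPrime (MvPolynomial.eval v)

namespace Endo

/-- The Jacobian matrix at `P`, in the affine chart `x_j = 1` with `j = chart P`, of the
dehomogenization `(f_i / f_j)_{i ≠ j}`. The partial derivatives are written out by the quotient
rule. -/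
noncomputable def multiplierMatrix (f : Endo K N d) (P : ℙ K (Fin (N + 1) → K)) :
    Matrix {i // i ≠ chart P} {i // i ≠ chart P} K :=
  Matrix.of fun i k =>
    (MvPolynomial.eval (coords P) (MvPolynomial.pderiv k.1 (f.poly i.1)) *
        MvPolynomial.eval (coords P) (f.poly (chart P)) -
      MvPolynomial.eval (coords P) (f.poly i.1) *
        MvPolynomial.eval (coords P) (MvPolynomial.pderiv k.1 (f.poly (chart P)))) /
      MvPolynomial.eval (coords P) (f.poly (chart P)) ^ 2

open Classical in
/-- The multiplier polynomial `γ_{f,P}`: the characteristic polynomial of the multiplier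
matrix. -/
noncomputable def multiplierPoly (f : Endo K N d) (P : ℙ K (Fin (N + 1) → K)) : K[X] :=
  (f.multiplierMatrix P).charpoly

/-- The ideal of the fixed point scheme of `f` in the affine chart `x_j = 1`, which is viewed as
a closed subscheme of affine `(N+1)`-space: the equations are `x_j = 1` and `f_i = x_i f_j`. -/
noncomputable def fixedIdeal (f : Endo K N d) (j : Fin (N + 1)) :
    Ideal (MvPolynomial (Fin (N + 1)) K) :=
  Ideal.span ({MvPolynomial.X j - 1} ∪
    Set.range fun i => f.poly i - MvPolynomial.X i * f.poly j)

/-- The multiplicity of the fixed point `P`: the `K`-dimension of the local ring at `P` of the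
fixed point scheme of `f`. -/
noncomputable def multiplicity (f : Endo K N d) (P : ℙ K (Fin (N + 1) → K)) : ℕ :=
  Module.finrank K
    (Localization.AtPrime (pointIdeal (coords P)) ⧸
      (f.fixedIdeal (chart P)).map
        (algebraMap (MvPolynomial (Fin (N + 1)) K)
          (Localization.AtPrime (pointIdeal (coords P)))))

/-- `Σ_1(f) = ∏_P (w - γ_{f,P}(t))`, the product over the fixed points of `f` counted with
multiplicity, as a polynomial in the outer variable `w` over `K[t]`. -/
noncomputable def multiplierSigma (f : Endo K N d) : K[X][X] :=
  ∏ᶠ P ∈ f.fixedPoints, (X - C (f.multiplierPoly P)) ^ f.multiplicity P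

/-- The fixed point multiplier map `τ_{d,1}^N`: the family of all coefficients of `Σ_1(f)`, where
`(a, b)` indexes the coefficient of `w^a t^b`. Up to sign these are the invariants `σ_{i,j}`, with
`a = D - i`, `b = N * i - j` and `D = 1 + d + ⋯ + d^N`; all other coefficients are zero. -/
noncomputable def multiplierMap (f : Endo K N d) : ℕ × ℕ → K :=
  fun p => ((f.multiplierSigma).coeff p.1).coeff p.2

end Endo

/-- The moduli space of degree `d` endomorphisms of `ℙ^N`, as the set of conjugacy classes. -/
def Moduli (K : Type*) [Field K] (N d : ℕ) : Type _ := Quotient (Endo.conjSetoid K N d)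

/-- The conjugacy class of an endomorphism. -/
def Endo.toModuli (f : Endo K N d) : Moduli K N d := Quotient.mk (Endo.conjSetoid K N d) f

/-- A polynomial map `F` of affine `N`-space is triangular if `F_i` involves only the variables
`x_j` with `j ≤ i`. -/
def IsTriangular (F : Fin N → MvPolynomial (Fin N) K) : Prop :=
  ∀ i, ∀ j ∈ (F i).vars, j ≤ i

/-- The homogenization to degree `d` of a polynomial of degree at most `d`; the new variable is
`x_0`, and the variables of `p` are shifted by one. -/
noncomputable def homogenize (d : ℕ) (p : MvPolynomial (Fin N) K) :
    MvPolynomial (Fin (N + 1)) K :=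
  ∑ m ∈ p.support, MvPolynomial.monomial (m.cons (d - m.degree)) (p.coeff m)

/-- The homogenization `[x_0^d, F_1, …, F_N]` of a polynomial map of affine `N`-space. -/
noncomputable def homogenizeMap (d : ℕ) (F : Fin N → MvPolynomial (Fin N) K) :
    Fin (N + 1) → MvPolynomial (Fin (N + 1)) K :=
  Fin.cons (MvPolynomial.X 0 ^ d) fun i => homogenize d (F i)

/-- The triangular polynomial endomorphisms of degree `d` of `ℙ^N`: the endomorphisms that are
the homogenization of a triangular polynomial map. -/
def triangularEndos (K : Type*) [Field K] (N d : ℕ) : Set (Endo K N d) :=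
  {f | ∃ F : Fin N → MvPolynomial (Fin N) K,
    IsTriangular F ∧ (∀ i, (F i).totalDegree ≤ d) ∧ f.poly = homogenizeMap d F}

end ProjDyn

/-! Lift `f` to a homogeneous self-map of affine `(N+1)`-space. With `x_0` first, the lift is again
a triangular system, and the fixed points of `f` are the lines through its nonzero fixed vectors.
The diagonal Jacobian entries of the lift at fixed vectors are the eigenvalues of the `df_P`, the
number `d` in the radial direction, and `0` at the origin. Hence `τ(g) = τ(f)` forces all
multipliers of `g` into the finite set `S` of multipliers of `f` (`Endo.multipliers_subset`). Only
the roots of `Σ_1` are used; of the multiplicities it matters only that they are nonzero.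

The generic condition is `NoVanishingSum`: no sum of fewer than `d` numbers `1/(s-1)` with `s ∈ S`
is zero. In one variable it leaves finitely many monic centred polynomials with fixed-point
multipliers in `S` (`finite_polynomials`). Indeed, along a non-constant family with constant
multipliers some fixed points would run apart at infinity, and comparing leading terms in the
Lagrange identity for a cluster of fixed points that separates from the others gives a vanishing sum
over that cluster (`sub_mem_range_of_prod_sub_eq`).

In several variables, a lower triangular linear conjugation makes each `f_i` monic and centred in
`x_i` (`exists_isConj_isNormalized`). Normalized systems are then counted one coordinate at a time
(`finite_normalized_systems`). The restrictions of `g_i` to the `x_i`-lines over the finitely many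
fixed vectors of the earlier equations are one-variable polynomials with multipliers in `S`. They
determine `g_i`: since no multiplier is `1`, the fixed vectors are simple, and a form of degree `d`
that vanishes at all of them is zero (`IsTriSystem.eq_zero_of_isHomogeneous`).

The power map satisfies the generic condition, because its multipliers are `0` and `d`. The
condition is open on triangular maps, because the vectors that violate it are integral over the ring
of coefficients (`exists_separating_element`). Density follows by joining any triangular map to the
power map by a line. -/

namespace ProjDyn

open Polynomial
open scoped LinearAlgebra.Projectivization

/-! ### Restriction of polynomials to coordinate lines. -/

section Slice

variable {K : Type*} [Field K] {n d : ℕ}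

/-- The restriction of a polynomial to the line through `v` parallel to the `i`-th axis, as a
polynomial in the `i`-th coordinate. -/
noncomputable def slice (v : Fin n → K) (i : Fin n) : MvPolynomial (Fin n) K →ₐ[K] K[X] :=
  MvPolynomial.aeval (Function.update (fun l => C (v l)) i X)

theorem eval_slice (v : Fin n → K) (i : Fin n) (p : MvPolynomial (Fin n) K) (x : K) :
    (slice v i p).eval x = MvPolynomial.eval (Function.update v i x) p := by
  have h : (Polynomial.aeval x).comp (slice v i) =
      MvPolynomial.aeval (Function.update v i x) := by
    apply MvPolynomial.algHom_ext
    intro l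
    by_cases hl : l = i
    · subst hl; simp [slice]
    · simp [slice, hl]
  have := DFunLike.congr_fun h p
  simpa [MvPolynomial.aeval_eq_eval, Polynomial.coe_aeval_eq_eval] using this

theorem eval_slice_self (v : Fin n → K) (i : Fin n) (p : MvPolynomial (Fin n) K) :
    (slice v i p).eval (v i) = MvPolynomial.eval v p := by
  rw [eval_slice, Function.update_eq_self]

theorem slice_eq_sum (v : Fin n → K) (i : Fin n) (p : MvPolynomial (Fin n) K) :
    slice v i p = ∑ m ∈ p.support,
      C (p.coeff m * ∏ l ∈ Finset.univ.erase i, v l ^ m l) * X ^ m i := by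
  rw [slice, MvPolynomial.aeval_def, MvPolynomial.eval₂_eq']
  refine Finset.sum_congr rfl fun m _ => ?_
  rw [← Finset.mul_prod_erase _ _ (Finset.mem_univ i)]
  have : ∏ l ∈ Finset.univ.erase i,
      (Function.update (fun l => (C (v l) : K[X])) i X l) ^ m l =
        C (∏ l ∈ Finset.univ.erase i, v l ^ m l) := by
    rw [map_prod]
    refine Finset.prod_congr rfl fun l hl => ?_
    rw [Function.update_of_ne (Finset.ne_of_mem_erase hl), map_pow]
  rw [this, Function.update_self, map_mul, Polynomial.algebraMap_eq]
  ring

theorem natDegree_slice_le (v : Fin n → K) (i : Fin n) (p : MvPolynomial (Fin n) K) :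
    (slice v i p).natDegree ≤ p.degreeOf i := by
  rw [slice_eq_sum]
  refine Polynomial.natDegree_sum_le_of_forall_le _ _ fun m hm => ?_
  exact (Polynomial.natDegree_C_mul_X_pow_le _ _).trans (MvPolynomial.monomial_le_degreeOf i hm)

theorem natDegree_slice_le_of_isHomogeneous (v : Fin n → K) (i : Fin n)
    {p : MvPolynomial (Fin n) K} (hp : p.IsHomogeneous d) : (slice v i p).natDegree ≤ d :=
  (natDegree_slice_le v i p).trans
    ((MvPolynomial.degreeOf_le_totalDegree p i).trans hp.totalDegree_le)

theorem eq_single_of_degree_eq {m : Fin n →₀ ℕ} {i : Fin n} (h : m.degree = m i) :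
    m = Finsupp.single i (m i) := by
  rw [Finsupp.degree_eq_sum, ← Finset.add_sum_erase _ _ (Finset.mem_univ i)] at h
  have h0 : ∑ l ∈ Finset.univ.erase i, m l = 0 := by omega
  ext l
  by_cases hl : l = i
  · subst hl; simp
  · rw [Finsupp.single_eq_of_ne hl]
    exact Finset.sum_eq_zero_iff.mp h0 l (Finset.mem_erase.mpr ⟨hl, Finset.mem_univ _⟩)

theorem degree_of_mem_support {p : MvPolynomial (Fin n) K} (hp : p.IsHomogeneous d)
    {m : Fin n →₀ ℕ} (hm : m ∈ p.support) : m.degree = d := by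
  have := hp (MvPolynomial.mem_support_iff.mp hm)
  rwa [Finsupp.degree_eq_weight_one]

theorem coeff_slice (v : Fin n → K) (i : Fin n) (p : MvPolynomial (Fin n) K) (k : ℕ) :
    (slice v i p).coeff k = ∑ m ∈ p.support,
      if m i = k then p.coeff m * ∏ l ∈ Finset.univ.erase i, v l ^ m l else 0 := by
  rw [slice_eq_sum, Polynomial.finsetSum_coeff]
  refine Finset.sum_congr rfl fun m _ => ?_
  rw [Polynomial.coeff_C_mul_X_pow]
  simp only [eq_comm]

theorem coeff_slice_top (v : Fin n → K) (i : Fin n) {p : MvPolynomial (Fin n) K}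
    (hp : p.IsHomogeneous d) : (slice v i p).coeff d = p.coeff (Finsupp.single i d) := by
  rw [coeff_slice, Finset.sum_eq_single (Finsupp.single i d)]
  · rw [if_pos (by simp), Finset.prod_eq_one, mul_one]
    intro l hl
    rw [Finsupp.single_eq_of_ne (Finset.ne_of_mem_erase hl), pow_zero]
  · intro m hm hne
    rw [if_neg]
    intro h
    have h1 := degree_of_mem_support hp hm
    apply hne
    rw [← h] at h1 ⊢
    exact eq_single_of_degree_eq h1
  · intro h
    simp [MvPolynomial.notMem_support_iff.mp h]

theorem eval_derivative_slice (v : Fin n → K) (i : Fin n) (p : MvPolynomial (Fin n) K) :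
    (derivative (slice v i p)).eval (v i) = MvPolynomial.eval v (MvPolynomial.pderiv i p) := by
  induction p using MvPolynomial.induction_on with
  | C a => simp [slice]
  | add p q hp hq => simp [hp, hq]
  | mul_X p l hp =>
    rw [map_mul, derivative_mul, MvPolynomial.pderiv_mul, Polynomial.eval_add,
      Polynomial.eval_mul, Polynomial.eval_mul, hp, eval_slice_self, eval_slice_self, map_add,
      map_mul, map_mul]
    by_cases hl : l = i
    · subst hl; simp [slice]
    · simp [slice, hl]

/-- The second coefficient of the slices of a homogeneous polynomial is a linear form in the base
point. -/
theorem exists_coeff_slice_eq_sum (i : Fin n) {p : MvPolynomial (Fin n) K}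
    (hp : p.IsHomogeneous (d + 1)) :
    ∃ c : Fin n → K, ∀ v, (slice v i p).coeff d = ∑ l, c l * v l := by
  have key : ∀ m ∈ p.support, ∃ c : Fin n → K, ∀ v : Fin n → K,
      (if m i = d then p.coeff m * ∏ l ∈ Finset.univ.erase i, v l ^ m l else 0) =
        ∑ l, c l * v l := by
    intro m hm
    by_cases h : m i = d
    · have h1 := degree_of_mem_support hp hm
      rw [Finsupp.degree_eq_sum, ← Finset.add_sum_erase _ _ (Finset.mem_univ i), h] at h1
      have h2 : ∑ l ∈ Finset.univ.erase i, m l = 1 := by omega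
      obtain ⟨k, hk, hk1⟩ : ∃ k ∈ Finset.univ.erase i, m k ≠ 0 := by
        by_contra! hcon
        rw [Finset.sum_eq_zero hcon] at h2
        omega
      rw [← Finset.add_sum_erase _ _ hk] at h2
      have h3 : m k = 1 := by omega
      have h4 : ∑ l ∈ (Finset.univ.erase i).erase k, m l = 0 := by omega
      refine ⟨Pi.single k (p.coeff m), fun v => ?_⟩
      rw [if_pos h, ← Finset.mul_prod_erase _ _ hk, h3, pow_one, Finset.prod_eq_one,
        Finset.sum_eq_single k]
      · simp
      · intro l _ hl; simp [hl]
      · simp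
      · intro l hl
        rw [Finset.sum_eq_zero_iff.mp h4 l hl, pow_zero]
    · exact ⟨0, fun v => by simp [h]⟩
  choose! c hc using key
  refine ⟨∑ m ∈ p.support, c m, fun v => ?_⟩
  rw [coeff_slice, Finset.sum_congr rfl fun m hm => hc m hm v, Finset.sum_comm]
  simp [Finset.sum_apply, Finset.sum_mul]

/-- The `i`-th coordinate of the base point is overwritten and the later ones do not occur, so only
the coordinates before `i` matter. -/
theorem slice_congr [Infinite K] {p : MvPolynomial (Fin n) K} {i : Fin n}
    (hp : DependsOn (fun v => MvPolynomial.eval v p) (Set.Iic i)) {v w : Fin n → K}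
    (h : ∀ l < i, v l = w l) : slice v i p = slice w i p := by
  refine Polynomial.funext fun x => ?_
  rw [eval_slice, eval_slice]
  refine hp fun l hl => ?_
  rcases eq_or_lt_of_le (Set.mem_Iic.mp hl) with rfl | hl
  · simp
  · simp [hl.ne, h l hl]

theorem eval_pderiv_congr [Infinite K] {p : MvPolynomial (Fin n) K} {i : Fin n}
    (hp : DependsOn (fun v => MvPolynomial.eval v p) (Set.Iic i)) {v w : Fin n → K}
    (h : ∀ l ≤ i, v l = w l) :
    MvPolynomial.eval v (MvPolynomial.pderiv i p) =
      MvPolynomial.eval w (MvPolynomial.pderiv i p) := by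
  rw [← eval_derivative_slice, ← eval_derivative_slice, h i le_rfl,
    slice_congr hp fun l hl => h l hl.le]

theorem eval_pderiv_update [Infinite K] (v : Fin n → K) (i : Fin n) (x : K)
    (p : MvPolynomial (Fin n) K) :
    MvPolynomial.eval (Function.update v i x) (MvPolynomial.pderiv i p) =
      (derivative (slice v i p)).eval x := by
  have h : slice (Function.update v i x) i p = slice v i p := by
    refine Polynomial.funext fun y => ?_
    rw [eval_slice, eval_slice, Function.update_idem]
  rw [← eval_derivative_slice, h, Function.update_self]

end Slice

/-! ### Triangular systems and their fixed vectors. -/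

/-- A system of homogeneous polynomials of degree `d`, the `i`-th of which depends only on the
variables `x_j` with `j ≤ i` and contains `x_i ^ d`. -/
structure IsTriSystem {K : Type*} [Field K] {n : ℕ} (d : ℕ)
    (g : Fin n → MvPolynomial (Fin n) K) : Prop where
  homogeneous : ∀ i, (g i).IsHomogeneous d
  dependsOn : ∀ i, DependsOn (fun v => MvPolynomial.eval v (g i)) (Set.Iic i)
  coeff_ne_zero : ∀ i, (g i).coeff (Finsupp.single i d) ≠ 0

section TriSystem

variable {K : Type*} [Field K] {n d : ℕ}

/-- The vectors fixed by a polynomial self-map of affine space. -/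
def fixedVectors (g : Fin n → MvPolynomial (Fin n) K) : Set (Fin n → K) :=
  {v | ∀ i, MvPolynomial.eval v (g i) = v i}

/-- The diagonal entries of the Jacobian matrices at the fixed vectors. -/
def multipliers (g : Fin n → MvPolynomial (Fin n) K) : Set K :=
  {x | ∃ v ∈ fixedVectors g, ∃ i, MvPolynomial.eval v (MvPolynomial.pderiv i (g i)) = x}

/-- The vectors that satisfy the first `k` fixed vector equations. -/
def partialFixed (g : Fin n → MvPolynomial (Fin n) K) (k : ℕ) : Set (Fin n → K) :=
  {v | ∀ i : Fin n, i.val < k → MvPolynomial.eval v (g i) = v i}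

theorem natDegree_slice_sub {g : MvPolynomial (Fin n) K} {i : Fin n} (hd : 2 ≤ d)
    (hg : g.IsHomogeneous d) (ha : g.coeff (Finsupp.single i d) ≠ 0) (v : Fin n → K) (c : K) :
    (slice v i g - C c * X).natDegree = d := by
  have h1 : (slice v i g).natDegree = d :=
    Polynomial.natDegree_eq_of_le_of_coeff_ne_zero (natDegree_slice_le_of_isHomogeneous v i hg)
      (by rwa [coeff_slice_top v i hg])
  rw [Polynomial.natDegree_sub_eq_left_of_natDegree_lt, h1]
  exact ((Polynomial.natDegree_C_mul_le c X).trans Polynomial.natDegree_X_le).trans_lt (by omega)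

/-- Solutions of the first equations of a triangular system extend to the remaining ones. -/
theorem exists_extension [IsAlgClosed K] (hd : 2 ≤ d) {g : Fin n → MvPolynomial (Fin n) K}
    (hom : ∀ i, (g i).IsHomogeneous d)
    (hdep : ∀ i, DependsOn (fun v => MvPolynomial.eval v (g i)) (Set.Iic i)) (k : ℕ)
    (ha : ∀ i : Fin n, k ≤ i.val → (g i).coeff (Finsupp.single i d) ≠ 0) (v : Fin n → K) (c : K) :
    ∃ w : Fin n → K, (∀ i : Fin n, i.val < k → w i = v i) ∧
      ∀ i : Fin n, k ≤ i.val → MvPolynomial.eval w (g i) = c * w i := by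
  -- The coordinates from `k` on are chosen one at a time as roots of one-variable polynomials. The
  -- factor `c` is `1` for fixed vectors and `0` for common zeros.
  have step : ∀ j, ∃ w : Fin n → K, (∀ i : Fin n, i.val < k → w i = v i) ∧
      ∀ i : Fin n, k ≤ i.val → i.val < j → MvPolynomial.eval w (g i) = c * w i := by
    intro j
    induction j with
    | zero => exact ⟨v, fun _ _ => rfl, fun _ _ h => absurd h (Nat.not_lt_zero _)⟩
    | succ j ih =>
      obtain ⟨w, hw1, hw2⟩ := ih
      by_cases hj : k ≤ j ∧ j < n
      · have hdeg := natDegree_slice_sub hd (hom ⟨j, hj.2⟩) (ha ⟨j, hj.2⟩ hj.1) w c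
        obtain ⟨x, hx⟩ := IsAlgClosed.exists_root (slice w ⟨j, hj.2⟩ (g ⟨j, hj.2⟩) - C c * X)
          (by
            intro h
            rw [Polynomial.natDegree_eq_zero_iff_degree_le_zero.mpr h.le] at hdeg
            omega)
        rw [Polynomial.IsRoot.def, Polynomial.eval_sub, eval_slice] at hx
        refine ⟨Function.update w ⟨j, hj.2⟩ x, fun i hi => ?_, fun i hi hij => ?_⟩
        · rw [Function.update_of_ne, hw1 i hi]
          rintro rfl
          exact absurd hi (by simpa using hj.1)
        · rcases Nat.lt_succ_iff_lt_or_eq.mp hij with h | h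
          · have hne : i ≠ ⟨j, hj.2⟩ := by rintro rfl; exact absurd h (lt_irrefl _)
            rw [Function.update_of_ne hne, ← hw2 i hi h]
            refine hdep i fun l hl => ?_
            rw [Function.update_of_ne]
            rintro rfl
            exact absurd (Fin.le_def.mp hl) (by simpa using h)
          · obtain rfl : i = ⟨j, hj.2⟩ := Fin.ext h
            rw [Function.update_self]
            simpa [sub_eq_zero] using hx
      · refine ⟨w, hw1, fun i hi hij => hw2 i hi ?_⟩
        have := i.isLt
        omega
  obtain ⟨w, hw1, hw2⟩ := step n
  exact ⟨w, hw1, fun i hi => hw2 i hi i.isLt⟩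

theorem IsTriSystem.exists_fixedVector [IsAlgClosed K] (hd : 2 ≤ d)
    {g : Fin n → MvPolynomial (Fin n) K} (hg : IsTriSystem d g) {k : ℕ} {v : Fin n → K}
    (hv : v ∈ partialFixed g k) :
    ∃ w ∈ fixedVectors g, ∀ i : Fin n, i.val < k → w i = v i := by
  obtain ⟨w, h1, h2⟩ := exists_extension hd hg.homogeneous hg.dependsOn k
    (fun i _ => hg.coeff_ne_zero i) v 1
  refine ⟨w, fun i => ?_, h1⟩
  rcases lt_or_ge i.val k with h | h
  · rw [h1 i h, ← hv i h]
    exact hg.dependsOn i fun l hl => h1 l (lt_of_le_of_lt (Fin.le_def.mp hl) h)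
  · rw [h2 i h, one_mul]

/-- The coordinates from `k` on are unconstrained by the first `k` equations, so they are pinned to
zero. Each earlier coordinate is a root of a polynomial of degree `d`. -/
theorem IsTriSystem.finite_partialFixed (hd : 2 ≤ d)
    {g : Fin n → MvPolynomial (Fin n) K} (hg : IsTriSystem d g) (k : ℕ) :
    (partialFixed g k ∩ {v | ∀ i : Fin n, k ≤ i.val → v i = 0}).Finite := by
  classical
  induction k with
  | zero =>
    refine (Set.finite_singleton (0 : Fin n → K)).subset fun v hv => ?_
    exact funext fun i => hv.2 i (Nat.zero_le _)
  | succ k ih =>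
    by_cases hk : k < n
    · set i : Fin n := ⟨k, hk⟩
      refine (ih.biUnion fun v _ => (((slice v i (g i) - C 1 * X).roots.toFinset :
        Set K).toFinite.image (Function.update v i))).subset fun v hv => ?_
      have hcong : ∀ l : Fin n, l.val < k → Function.update v i 0 l = v l := fun l hl => by
        rw [Function.update_of_ne]
        rintro rfl
        exact absurd hl (lt_irrefl _)
      refine Set.mem_biUnion (x := Function.update v i 0) ⟨fun l hl => ?_, fun l hl => ?_⟩ ?_
      · rw [hcong l hl, ← hv.1 l (hl.trans (Nat.lt_succ_self k))]
        exact hg.dependsOn l fun j hj => hcong j (lt_of_le_of_lt (Fin.le_def.mp hj) hl)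
      · by_cases hl' : l = i
        · rw [hl', Function.update_self]
        · rw [Function.update_of_ne hl']
          refine hv.2 l (Nat.succ_le_of_lt (lt_of_le_of_ne hl fun h => hl' (Fin.ext h.symm)))
      · refine ⟨v i, ?_, by simp⟩
        have hdeg := natDegree_slice_sub hd (hg.homogeneous i) (hg.coeff_ne_zero i)
          (Function.update v i 0) 1
        rw [Finset.mem_coe, Multiset.mem_toFinset, Polynomial.mem_roots (by
          intro h; rw [h, natDegree_zero] at hdeg; omega), Polynomial.IsRoot.def,
          Polynomial.eval_sub, eval_slice, Function.update_idem, Function.update_eq_self,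
          hv.1 i (Nat.lt_succ_self k)]
        simp
    · refine ih.subset fun v hv => ⟨fun l hl => hv.1 l (by omega), fun l hl => ?_⟩
      exact absurd l.isLt (by omega)

theorem IsTriSystem.finite_fixedVectors (hd : 2 ≤ d)
    {g : Fin n → MvPolynomial (Fin n) K} (hg : IsTriSystem d g) : (fixedVectors g).Finite := by
  refine (hg.finite_partialFixed hd n).subset fun v hv => ⟨fun i _ => hv i, fun i hi => ?_⟩
  exact absurd i.isLt (by omega)

theorem IsTriSystem.update_mem_partialFixed {g : Fin n → MvPolynomial (Fin n) K}
    (hg : IsTriSystem d g) {i : Fin n} {v : Fin n → K} (hv : v ∈ partialFixed g i) {x : K}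
    (hx : (slice v i (g i)).eval x = x) : Function.update v i x ∈ partialFixed g (i + 1) := by
  intro l hl
  rcases Nat.lt_succ_iff_lt_or_eq.mp hl with h | h
  · have hcong : ∀ m : Fin n, m.val < i → Function.update v i x m = v m := fun m hm => by
      rw [Function.update_of_ne]
      rintro rfl
      exact absurd hm (lt_irrefl _)
    rw [hcong l h, ← hv l h]
    exact hg.dependsOn l fun m hm => hcong m (lt_of_le_of_lt (Fin.le_def.mp hm) h)
  · obtain rfl : l = i := Fin.ext h
    rw [Function.update_self, ← eval_slice, hx]

/-- A fixed point of the slice prolongs the partial fixed vector by one coordinate, and the result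
extends to a full fixed vector without changing the `i`-th diagonal derivative. -/
theorem IsTriSystem.eval_derivative_slice_mem_multipliers [IsAlgClosed K] (hd : 2 ≤ d)
    {g : Fin n → MvPolynomial (Fin n) K} (hg : IsTriSystem d g) {i : Fin n} {v : Fin n → K}
    (hv : v ∈ partialFixed g i) {x : K} (hx : (slice v i (g i)).eval x = x) :
    (derivative (slice v i (g i))).eval x ∈ multipliers g := by
  obtain ⟨w, hw, hwv⟩ := hg.exists_fixedVector hd (hg.update_mem_partialFixed hv hx)
  refine ⟨w, hw, i, ?_⟩
  rw [eval_pderiv_congr (hg.dependsOn i) (w := Function.update v i x) fun l hl =>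
    hwv l (Nat.lt_succ_of_le (Fin.le_def.mp hl)), eval_pderiv_update]

/-- A polynomial of degree less than `d` in each variable that vanishes at the fixed vectors is
zero if no multiplier is `1`. -/
theorem IsTriSystem.eq_zero_of_degreeOf_lt [IsAlgClosed K] (hd : 2 ≤ d)
    {g : Fin n → MvPolynomial (Fin n) K} (hg : IsTriSystem d g) (h1 : 1 ∉ multipliers g)
    {c : MvPolynomial (Fin n) K} (hc : ∀ i, c.degreeOf i < d)
    (hv : ∀ v ∈ fixedVectors g, MvPolynomial.eval v c = 0) : c = 0 := by
  -- Descending induction on `k`: each step drops one equation, from the full fixed vectors to all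
  -- of affine space.
  have step : ∀ j k, k + j = n → ∀ v ∈ partialFixed g k, MvPolynomial.eval v c = 0 := by
    classical
    intro j
    induction j with
    | zero => exact fun k hk v hvk => hv v fun i => hvk i (by omega)
    | succ j ih =>
      intro k hk v hvk
      set i : Fin n := ⟨k, by omega⟩
      set q := slice v i (g i) - C 1 * X with hq
      have hdeg : q.natDegree = d :=
        natDegree_slice_sub hd (hg.homogeneous i) (hg.coeff_ne_zero i) v 1
      have hq0 : q ≠ 0 := by intro h; rw [h, natDegree_zero] at hdeg; omega
      have hfix : ∀ x, q.IsRoot x → (slice v i (g i)).eval x = x := by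
        intro x hx
        rw [Polynomial.IsRoot.def, hq] at hx
        simpa [sub_eq_zero] using hx
      -- A double root of `p - X`, where `p` is the slice, is a fixed point with multiplier `1`.
      have hnodup : q.roots.Nodup := by
        rw [Multiset.nodup_iff_count_le_one]
        intro x
        rw [count_roots]
        by_contra! hcon
        obtain ⟨hx, hx'⟩ := (Polynomial.one_lt_rootMultiplicity_iff_isRoot hq0).mp hcon
        have hmem := hg.eval_derivative_slice_mem_multipliers hd hvk (hfix x hx)
        rw [Polynomial.IsRoot.def, hq] at hx'
        have hx1 : (derivative (slice v i (g i))).eval x = 1 := by simpa [sub_eq_zero] using hx'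
        exact h1 (hx1 ▸ hmem)
      have hcard : q.roots.toFinset.card = d := by
        rw [Multiset.toFinset_card_of_nodup hnodup,
          ← (IsAlgClosed.splits q).natDegree_eq_card_roots, hdeg]
      have hzero : slice v i c = 0 := by
        refine Polynomial.eq_zero_of_natDegree_lt_card_of_eval_eq_zero' _ q.roots.toFinset ?_ ?_
        · intro x hx
          rw [eval_slice]
          refine ih (k + 1) (by omega) _ (hg.update_mem_partialFixed hvk (hfix x ?_))
          exact Polynomial.isRoot_of_mem_roots (Multiset.mem_toFinset.mp hx)
        · rw [hcard]
          exact (natDegree_slice_le v i c).trans_lt (hc i)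
      rw [← eval_slice_self v i, hzero, Polynomial.eval_zero]
  refine MvPolynomial.funext fun v => ?_
  rw [map_zero]
  exact step n 0 (Nat.zero_add n) v fun i hi => absurd hi (Nat.not_lt_zero _)

theorem degreeOf_lt_of_coeff_single_eq_zero {c : MvPolynomial (Fin n) K} (hd : d ≠ 0)
    (hc : c.IsHomogeneous d) {i : Fin n} (h : c.coeff (Finsupp.single i d) = 0) :
    c.degreeOf i < d := by
  rw [MvPolynomial.degreeOf_lt_iff (Nat.pos_of_ne_zero hd)]
  intro m hm
  have h1 := degree_of_mem_support hc hm
  refine lt_of_le_of_ne (h1 ▸ Finsupp.le_degree i m) fun h2 => ?_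
  rw [← h2] at h1
  rw [MvPolynomial.mem_support_iff, eq_single_of_degree_eq h1, h2] at hm
  exact hm h

theorem IsTriSystem.coeff_single_of_lt [Infinite K]
    {g : Fin n → MvPolynomial (Fin n) K} (hd : d ≠ 0) (hg : IsTriSystem d g) {i l : Fin n}
    (h : i < l) : (g i).coeff (Finsupp.single l d) = 0 := by
  rw [← coeff_slice_top 0 l (hg.homogeneous i)]
  have : slice (0 : Fin n → K) l (g i) = C (MvPolynomial.eval 0 (g i)) := by
    refine Polynomial.funext fun x => ?_
    rw [eval_slice, eval_C]
    refine hg.dependsOn i fun j hj => ?_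
    rw [Function.update_of_ne (ne_of_lt (lt_of_le_of_lt (Set.mem_Iic.mp hj) h))]
  rw [this, Polynomial.coeff_C_of_ne_zero hd]

/-- Reduce `c` modulo the fixed vector equations: subtract multiples of the `g k` to kill the pure
powers, and put back the same multiples of `x_k`. The remainder has degree below `d` in each
variable, hence vanishes, and homogeneity then kills the multiples. -/
theorem IsTriSystem.eq_zero_of_isHomogeneous [IsAlgClosed K] (hd : 2 ≤ d)
    {g : Fin n → MvPolynomial (Fin n) K} (hg : IsTriSystem d g) (h1 : 1 ∉ multipliers g)
    {c : MvPolynomial (Fin n) K} (hc : c.IsHomogeneous d)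
    (hv : ∀ v ∈ fixedVectors g, MvPolynomial.eval v c = 0) : c = 0 := by
  -- Solving for the pure powers is possible since `M` is upper triangular with nonzero diagonal.
  let M : Matrix (Fin n) (Fin n) K := Matrix.of fun l k => (g k).coeff (Finsupp.single l d)
  have hM : IsUnit M.det := by
    rw [Matrix.det_of_isUpperTriangular (M := M)
      (fun l k h => hg.coeff_single_of_lt (by omega) h), isUnit_iff_ne_zero]
    exact Finset.prod_ne_zero_iff.mpr fun i _ => hg.coeff_ne_zero i
  obtain ⟨β, hβ⟩ := (Matrix.mulVec_surjective_iff_isUnit.mpr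
    ((Matrix.isUnit_iff_isUnit_det M).mpr hM)) fun l => c.coeff (Finsupp.single l d)
  have hc1 : (c - ∑ k, MvPolynomial.C (β k) * g k).IsHomogeneous d := by
    refine hc.sub (MvPolynomial.IsHomogeneous.sum _ _ _ fun k _ => ?_)
    simpa using (MvPolynomial.isHomogeneous_C _ (β k)).mul (hg.homogeneous k)
  have hlin : (∑ k, MvPolynomial.C (β k) * MvPolynomial.X k :
      MvPolynomial (Fin n) K).IsHomogeneous 1 := by
    refine MvPolynomial.IsHomogeneous.sum _ _ _ fun k _ => ?_
    simpa using (MvPolynomial.isHomogeneous_C _ (β k)).mul (MvPolynomial.isHomogeneous_X K k)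
  have hzero : (c - ∑ k, MvPolynomial.C (β k) * g k) +
      ∑ k, MvPolynomial.C (β k) * MvPolynomial.X k = 0 := by
    refine hg.eq_zero_of_degreeOf_lt hd h1 (fun i => ?_) fun v hvv => ?_
    · refine (MvPolynomial.degreeOf_add_le _ _ _).trans_lt (max_lt ?_ ?_)
      · refine degreeOf_lt_of_coeff_single_eq_zero (by omega) hc1 ?_
        have := congrFun hβ i
        simp only [Matrix.mulVec, dotProduct, M, Matrix.of_apply] at this
        rw [MvPolynomial.coeff_sub, MvPolynomial.coeff_sum, ← this, sub_eq_zero]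
        refine Finset.sum_congr rfl fun k _ => ?_
        rw [MvPolynomial.coeff_C_mul, mul_comm]
      · refine lt_of_le_of_lt ?_ (show 1 < d by omega)
        exact (MvPolynomial.degreeOf_le_totalDegree _ _).trans hlin.totalDegree_le
    · simp only [map_add, map_sub, map_sum, map_mul, MvPolynomial.eval_C, MvPolynomial.eval_X,
        hv v hvv, hvv _]
      ring
  -- The identity mixes degrees `d` and `1`, which differ, so the linear part vanishes separately.
  have h2 := congrArg (MvPolynomial.homogeneousComponent 1) hzero
  rw [map_add, MvPolynomial.homogeneousComponent_of_mem hc1,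
    MvPolynomial.homogeneousComponent_of_mem hlin, if_neg (by omega), if_pos rfl, zero_add,
    map_zero] at h2
  have h3 : β = 0 := by
    funext k
    have := congrArg (MvPolynomial.eval (Pi.single k 1)) h2
    simpa [Pi.single_apply] using this
  simpa [h3] using hzero

end TriSystem

/-! ### One-variable polynomials with prescribed fixed-point multipliers. -/

section OneVariable

/-- The factors are exchanged one at a time, each exchange costing strictly less than the maximal
size of the product. It serves to treat the points of a cluster as equal when seen from outside. -/
theorem valuation_prod_sub_prod_lt {L Γ ι : Type*} [Field L]
    [LinearOrderedCommGroupWithZero Γ] (v : Valuation L Γ) {ρ : Γ} (hρ : 0 < ρ) (s : Finset ι)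
    {a b : ι → L} (ha : ∀ j ∈ s, v (a j) ≤ ρ) (hb : ∀ j ∈ s, v (b j) ≤ ρ)
    (hab : ∀ j ∈ s, v (a j - b j) < ρ) : v (∏ j ∈ s, a j - ∏ j ∈ s, b j) < ρ ^ s.card := by
  classical
  induction s using Finset.induction_on with
  | empty => simp
  | insert j s hj ih =>
    have ih := ih (fun k hk => ha k (Finset.mem_insert_of_mem hk))
      (fun k hk => hb k (Finset.mem_insert_of_mem hk))
      (fun k hk => hab k (Finset.mem_insert_of_mem hk))
    have hprod : v (∏ k ∈ s, b k) ≤ ρ ^ s.card := by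
      rw [map_prod]
      exact Finset.prod_le_pow_card _ _ _ fun k hk => hb k (Finset.mem_insert_of_mem hk)
    rw [Finset.prod_insert hj, Finset.prod_insert hj, Finset.card_insert_of_notMem hj, pow_succ']
    have : a j * ∏ k ∈ s, a k - b j * ∏ k ∈ s, b k =
        a j * (∏ k ∈ s, a k - ∏ k ∈ s, b k) + (a j - b j) * ∏ k ∈ s, b k := by ring
    rw [this]
    refine v.map_add_lt ?_ ?_
    · rw [map_mul]
      exact (mul_le_mul_left (ha j (Finset.mem_insert_self _ _)) _).trans_lt
        ((mul_lt_mul_iff_right₀ hρ).mpr ih)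
    · rw [map_mul]
      exact (mul_le_mul_right hprod _).trans_lt
        ((mul_lt_mul_iff_left₀ (pow_pos hρ _)).mpr (hab j (Finset.mem_insert_self _ _)))

variable {K : Type*} [Field K]

/-- An algebraically closed field is integrally closed in any extension, and an integrally closed
subring is the intersection of the valuation rings above it. The ring found is a place at which `x`
has a pole. -/
theorem exists_valuationSubring_of_notMem_range [IsAlgClosed K] {L : Type*} [Field L] [Algebra K L]
    {x : L} (hx : x ∉ (algebraMap K L).range) :
    ∃ V : ValuationSubring L, (algebraMap K L).range ≤ V.toSubring ∧ x ∉ V := by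
  have : IsIntegrallyClosedIn (algebraMap K L).range L := by
    rw [Subring.isIntegrallyClosedIn_iff]
    intro y hy
    have hy' : IsIntegral K y := by
      obtain ⟨p, hp, hpy⟩ := hy
      obtain ⟨q, hq, -, hqm⟩ := Polynomial.lifts_and_natDegree_eq_and_monic
        (f := (algebraMap K L).rangeRestrict) (p := p)
        ((Polynomial.mem_lifts _).mpr
          (Polynomial.map_surjective _ (algebraMap K L).rangeRestrict_surjective p)) hp
      refine ⟨q, hqm, ?_⟩
      rw [← hq, Polynomial.eval₂_map] at hpy
      exact hpy
    exact minpoly.mem_range_of_degree_eq_one K y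
      (IsAlgClosed.degree_eq_one_of_irreducible K (minpoly.irreducible hy'))
  exact Subring.exists_le_valuationSubring_of_isIntegrallyClosedIn hx

/-- If the products of the differences of `z i` with the other `z j` are constants whose inverses
have no vanishing proper subsums, then the differences themselves are constants. -/
theorem sub_mem_range_of_prod_sub_eq [IsAlgClosed K] {L : Type*} [Field L] [Algebra K L] {d : ℕ}
    {z : Fin d → L} {m : Fin d → K} (hm0 : ∀ i, m i ≠ 0)
    (hm : ∀ I : Finset (Fin d), I.Nonempty → I ≠ Finset.univ → ∑ i ∈ I, (m i)⁻¹ ≠ 0)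
    (hz : ∀ i, ∏ j ∈ Finset.univ.erase i, (z i - z j) = algebraMap K L (m i)) (i j : Fin d) :
    z i - z j ∈ (algebraMap K L).range := by
  classical
  by_contra hij
  obtain ⟨V, hKV, hV⟩ := exists_valuationSubring_of_notMem_range hij
  set v := V.valuation
  have hconst : ∀ c : K, c ≠ 0 → v (algebraMap K L c) = 1 := by
    intro c hc
    refine le_antisymm ((V.valuation_le_one_iff _).mpr (hKV ⟨c, rfl⟩)) ?_
    have h := (V.valuation_le_one_iff _).mpr (hKV ⟨c⁻¹, rfl⟩)
    rw [map_inv₀, map_inv₀] at h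
    exact (inv_le_one₀ (by
      rw [zero_lt_iff, Valuation.ne_zero_iff]
      exact (_root_.map_ne_zero _).mpr hc)).mp h
  -- The two points that run apart fastest; `ρ` is the scale at which the cluster `I` around `z p`
  -- is seen as a single point.
  obtain ⟨⟨p, q⟩, -, hmax⟩ := Finset.exists_max_image (Finset.univ : Finset (Fin d × Fin d))
    (fun x => v (z x.1 - z x.2)) ⟨(i, j), Finset.mem_univ _⟩
  set ρ := v (z p - z q) with hρ
  have hle : ∀ k l, v (z k - z l) ≤ ρ := fun k l => hmax (k, l) (Finset.mem_univ _)
  have hρ1 : 1 < ρ := lt_of_lt_of_le (by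
    rw [← not_le, V.valuation_le_one_iff]; exact hV) (hle i j)
  have hρ0 : 0 < ρ := zero_lt_one.trans hρ1
  set I : Finset (Fin d) := Finset.univ.filter fun k => v (z k - z p) < ρ with hI
  have hpI : p ∈ I := by simp [hI, hρ0]
  have hqI : q ∉ I := by
    simp only [hI, Finset.mem_filter, Finset.mem_univ, true_and, not_lt]
    rw [hρ, v.map_sub_swap]
  have hfar : ∀ k ∈ I, ∀ l ∈ Iᶜ, v (z k - z l) = ρ := by
    intro k hk l hl
    simp only [hI, Finset.mem_filter, Finset.mem_univ, true_and, Finset.mem_compl, not_lt] at hk hl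
    have h : v (z l - z p) = ρ := le_antisymm (hle _ _) hl
    have : z k - z l = (z k - z p) - (z l - z p) := by ring
    rw [this, v.map_sub_swap, Valuation.map_sub_eq_of_lt_left _ (by rwa [h]), h]
  -- The part of the product that comes from outside the cluster: all `c k` have size `ρ ^ |Iᶜ|` and
  -- agree to leading order.
  set c : Fin d → L := fun k => ∏ l ∈ Iᶜ, (z k - z l) with hc
  have hcv : ∀ k ∈ I, v (c k) = ρ ^ (Iᶜ).card := by
    intro k hk
    rw [hc, map_prod, Finset.prod_congr rfl fun l hl => hfar k hk l hl, Finset.prod_const]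
  have hcd : ∀ k ∈ I, v (c k - c p) < ρ ^ (Iᶜ).card := by
    intro k hk
    refine valuation_prod_sub_prod_lt v hρ0 _ (fun l _ => hle _ _) (fun l _ => hle _ _) ?_
    intro l _
    rw [sub_sub_sub_cancel_right]
    exact (Finset.mem_filter.mp hk).2
  have hinj : Set.InjOn z (I : Set (Fin d)) := by
    intro k _ l _ hkl
    by_contra hne
    have := hz k
    rw [Finset.prod_eq_zero (Finset.mem_erase.mpr ⟨Ne.symm hne, Finset.mem_univ l⟩)
      (sub_eq_zero.mpr hkl)] at this
    exact hm0 k ((map_eq_zero _).mp this.symm)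
  have hsplit : ∀ k ∈ I, (∏ l ∈ I.erase k, (z k - z l)) * c k = algebraMap K L (m k) := by
    intro k hk
    rw [← hz k, hc, ← Finset.prod_union]
    · refine Finset.prod_congr ?_ fun _ _ => rfl
      ext l
      by_cases hl : l ∈ I
      · simp [hl]
      · simp only [Finset.mem_union, Finset.mem_erase, Finset.mem_compl, hl, not_false_eq_true,
          or_true, Finset.mem_univ, and_true, true_iff]
        rintro rfl
        exact hl hk
    · exact Finset.disjoint_left.mpr fun l hl hl' =>
        Finset.mem_compl.mp hl' (Finset.mem_of_mem_erase hl)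
  -- If `z p` were alone, `m p` would equal `c p`, which has a pole, while nonzero constants have
  -- valuation `1`.
  have hcard : 1 < I.card := by
    by_contra hcon
    have hI1 : I = {p} := by
      refine (Finset.eq_of_subset_of_card_le (Finset.singleton_subset_iff.mpr hpI) ?_).symm
      simpa using hcon
    have h := hsplit p hpI
    rw [hI1, Finset.erase_singleton, Finset.prod_empty, one_mul] at h
    have h2 := hcv p hpI
    rw [h, hconst _ (hm0 p)] at h2
    have : 1 < ρ ^ (Iᶜ).card := one_lt_pow₀ hρ1 (Finset.card_ne_zero_of_mem
      (Finset.mem_compl.mpr hqI))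
    exact absurd h2 this.ne
  -- The coefficient of degree `|I| - 1` of the constant `1`, read off from Lagrange interpolation
  -- at the nodes `z k` with `k ∈ I`. It is zero because `|I| > 1`.
  have hsum : ∑ k ∈ I, c k * (algebraMap K L (m k))⁻¹ = 0 := by
    have h := Lagrange.coeff_eq_sum hinj (P := (1 : L[X])) (by
      rw [Polynomial.degree_one]; exact_mod_cast zero_lt_one.trans hcard)
    rw [Polynomial.coeff_one, if_neg (by omega)] at h
    rw [h]
    refine Finset.sum_congr rfl fun k hk => ?_
    have hck : c k ≠ 0 := by
      rw [← Valuation.ne_zero_iff v, hcv k hk]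
      exact (pow_pos hρ0 _).ne'
    rw [← hsplit k hk, Polynomial.eval_one, mul_inv, mul_left_comm, mul_inv_cancel₀ hck, mul_one,
      one_div]
  -- Replacing every `c k` by `c p` leaves only lower-order terms on the right, whereas on the left
  -- the sum of the `(m k)⁻¹` is a nonzero constant.
  have hsum2 : c p * algebraMap K L (∑ k ∈ I, (m k)⁻¹) =
      -∑ k ∈ I, (c k - c p) * (algebraMap K L (m k))⁻¹ := by
    rw [eq_neg_iff_add_eq_zero, ← hsum, map_sum, Finset.mul_sum, ← Finset.sum_add_distrib]
    refine Finset.sum_congr rfl fun k _ => ?_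
    rw [map_inv₀]; ring
  have h1 : v (c p * algebraMap K L (∑ k ∈ I, (m k)⁻¹)) = ρ ^ (Iᶜ).card := by
    rw [map_mul, hcv p hpI, hconst _ (hm I ⟨p, hpI⟩ fun h => hqI (h ▸ Finset.mem_univ q)), mul_one]
  have h2 : v (-∑ k ∈ I, (c k - c p) * (algebraMap K L (m k))⁻¹) < ρ ^ (Iᶜ).card := by
    rw [Valuation.map_neg]
    refine v.map_sum_lt (pow_pos hρ0 _).ne' fun k hk => ?_
    rw [map_mul, map_inv₀, hconst _ (hm0 k), inv_one, mul_one]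
    exact hcd k hk
  rw [← hsum2, h1] at h2
  exact lt_irrefl _ h2

/-- On each irreducible component of the solution variety the differences of coordinates are
constant. The prescribed sum removes the remaining translation, on dividing by `d`. So every
component is a point, and a Noetherian ring has finitely many minimal primes. -/
theorem finite_prod_sub_eq [IsAlgClosed K] [CharZero K] {d : ℕ} {m : Fin d → K}
    (hm0 : ∀ i, m i ≠ 0)
    (hm : ∀ I : Finset (Fin d), I.Nonempty → I ≠ Finset.univ → ∑ i ∈ I, (m i)⁻¹ ≠ 0) (e : K) :
    {z : Fin d → K | (∀ i, ∏ j ∈ Finset.univ.erase i, (z i - z j) = m i) ∧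
      ∑ i, z i = e}.Finite := by
  classical
  let J : Ideal (MvPolynomial (Fin d) K) := Ideal.span
    (insert (∑ i, MvPolynomial.X i - MvPolynomial.C e) (Set.range fun i =>
      ∏ j ∈ Finset.univ.erase i, (MvPolynomial.X i - MvPolynomial.X j) - MvPolynomial.C (m i)))
  have key : ∀ P ∈ J.minimalPrimes, ∃ c : Fin d → K, ∀ i,
      MvPolynomial.X i - MvPolynomial.C (c i) ∈ P := by
    intro P hP
    have : P.IsPrime := hP.1.1
    let L := FractionRing (MvPolynomial (Fin d) K ⧸ P)
    let φ : MvPolynomial (Fin d) K →ₐ[K] L :=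
      (IsScalarTower.toAlgHom K (MvPolynomial (Fin d) K ⧸ P) L).comp (Ideal.Quotient.mkₐ K P)
    have hφ : ∀ x, φ x = 0 ↔ x ∈ P := by
      intro x
      have : φ x = algebraMap (MvPolynomial (Fin d) K ⧸ P) L (Ideal.Quotient.mk P x) := rfl
      rw [this, FaithfulSMul.algebraMap_eq_zero_iff, Ideal.Quotient.eq_zero_iff_mem]
    have hC : ∀ a, φ (MvPolynomial.C a) = algebraMap K L a := fun a => φ.commutes a
    have hsum : ∑ i, φ (MvPolynomial.X i) = algebraMap K L e := by
      have h : φ (∑ i, MvPolynomial.X i - MvPolynomial.C e) = 0 :=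
        (hφ _).mpr (hP.1.2 (Ideal.subset_span (Set.mem_insert _ _)))
      rwa [map_sub, map_sum, hC, sub_eq_zero] at h
    have hprod : ∀ i, ∏ j ∈ Finset.univ.erase i,
        (φ (MvPolynomial.X i) - φ (MvPolynomial.X j)) = algebraMap K L (m i) := by
      intro i
      have h := (hφ _).mpr (hP.1.2 (Ideal.subset_span (Set.mem_insert_of_mem _ ⟨i, rfl⟩)))
      rw [map_sub, map_prod, hC, sub_eq_zero] at h
      simpa only [map_sub] using h
    have hrange : ∀ i, ∃ a, algebraMap K L a = φ (MvPolynomial.X i) := by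
      intro i
      choose a ha using fun j => sub_mem_range_of_prod_sub_eq hm0 hm hprod i j
      have hd : (d : K) ≠ 0 := by
        have := i.isLt
        exact_mod_cast (by omega : d ≠ 0)
      refine ⟨(∑ j, a j + e) / d, ?_⟩
      rw [map_div₀, map_add, map_sum, Finset.sum_congr rfl fun j _ => ha j,
        Finset.sum_sub_distrib, hsum, map_natCast, div_eq_iff (by
          rw [← map_natCast (algebraMap K L)]; exact (_root_.map_ne_zero _).mpr hd)]
      simp [mul_comm]
    choose c hc using hrange
    exact ⟨c, fun i => (hφ _).mp (by rw [map_sub, hC, hc, sub_self])⟩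
  choose! c hc using key
  refine (J.finite_minimalPrimes_of_isNoetherianRing.image c).subset fun z hz => ?_
  have hker : J ≤ RingHom.ker (MvPolynomial.eval z) := by
    refine Ideal.span_le.mpr (Set.insert_subset ?_ ?_)
    · simp [RingHom.mem_ker, hz.2]
    · rintro _ ⟨i, rfl⟩
      simp only [SetLike.mem_coe, RingHom.mem_ker, map_sub, map_prod, MvPolynomial.eval_X,
        MvPolynomial.eval_C]
      rw [hz.1 i, sub_self]
  have : (RingHom.ker (MvPolynomial.eval z)).IsPrime := RingHom.ker_isPrime _
  obtain ⟨P, hP, hPz⟩ := Ideal.exists_minimalPrimes_le hker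
  refine ⟨P, hP, funext fun i => ?_⟩
  have := hPz (hc P hP i)
  rw [RingHom.mem_ker] at this
  simpa [sub_eq_zero, eq_comm] using this

/-- No sum of fewer than `d` of the numbers `1 / (s - 1)`, with `s ∈ S`, vanishes. -/
def NoVanishingSum (d : ℕ) (S : Set K) : Prop :=
  ∀ M : Multiset K, M ≠ 0 → M.card < d → (∀ s ∈ M, s ∈ S) → (M.map fun s => (s - 1)⁻¹).sum ≠ 0

/-- By the convention `0⁻¹ = 0`, the value `s = 1` gives a vanishing sum with one term. -/
theorem NoVanishingSum.one_notMem {d : ℕ} (hd : 2 ≤ d) {S : Set K} (hS : NoVanishingSum d S) :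
    1 ∉ S := by
  intro h
  refine hS {1} (by simp) (by rw [Multiset.card_singleton]; omega) (by simpa using h) (by simp)

theorem exists_fin_map_eq {α : Type*} {k : ℕ} (M : Multiset α) (h : M.card = k) :
    ∃ z : Fin k → α, Finset.univ.val.map z = M := by
  have hlen : M.toList.length = k := by rw [Multiset.length_toList, h]
  refine ⟨fun i => M.toList.get (i.cast hlen.symm), ?_⟩
  rw [Fin.univ_val_map]
  refine Eq.trans ?_ (Multiset.coe_toList M)
  refine congrArg _ ?_
  refine List.ext_getElem (by simp [h]) fun k h1 h2 => by simp

/-- If `z` lists the fixed points, then `p - X = ∏ (X - z i)` and `p'(z i) - 1 = ∏_{j ≠ i} (z i - z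
j)`. Centring fixes the sum of the `z i`, and there are finitely many choices of the multipliers in
`S`. The simple fixed points make the sum of all `d` reciprocals vanish automatically, so only
proper subsums can be excluded. -/
theorem finite_polynomials [IsAlgClosed K] [CharZero K] {d : ℕ} (hd : 2 ≤ d) {S : Set K}
    (hfin : S.Finite) (hS : NoVanishingSum d S) :
    {p : K[X] | (p - X ^ d).natDegree + 2 ≤ d ∧
      ∀ x, p.eval x = x → (derivative p).eval x ∈ S}.Finite := by
  classical
  -- This is `1` if `d = 2` and `0` otherwise: for `d = 2` the subtracted `X` contributes to the
  -- second coefficient of `p - X`.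
  set e : K := (X : K[X]).coeff (d - 1) with he
  refine ((Set.Finite.pi' fun _ : Fin d => hfin).biUnion (t := fun s => (fun z : Fin d → K =>
    X + Lagrange.nodal Finset.univ z) '' {z | s ∈ {s : Fin d → K | ∀ i, s i ∈ S} ∧
      (∀ i, ∏ j ∈ Finset.univ.erase i, (z i - z j) = s i - 1) ∧ ∑ i, z i = e}) ?_).subset ?_
  · intro s hs
    refine Set.Finite.image _ ?_
    refine (finite_prod_sub_eq (m := fun i => s i - 1) ?_ ?_ e).subset fun z hz => hz.2
    · intro i hi
      exact hS.one_notMem hd (sub_eq_zero.mp hi ▸ hs i)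
    · intro I hI hI'
      have := hS (I.val.map s) (by simpa using hI.ne_empty) ?_ ?_
      · simpa using this
      · rw [Multiset.card_map]
        simpa using Finset.card_lt_card (Finset.ssubset_univ_iff.mpr hI')
      · simp only [Multiset.mem_map]
        rintro _ ⟨i, -, rfl⟩
        exact hs i
  · rintro p ⟨hp, hpS⟩
    set r := p - X ^ d with hr
    have hpe : p - X = X ^ d + (r - X) := by rw [hr]; ring
    have hlt : (r - X).degree < (d : WithBot ℕ) := by
      refine (Polynomial.degree_sub_le _ _).trans_lt (max_lt ?_ ?_)
      · refine Polynomial.degree_le_natDegree.trans_lt ?_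
        exact_mod_cast (by omega : r.natDegree < d)
      · rw [Polynomial.degree_X]
        exact_mod_cast (by omega : 1 < d)
    have hmonic : (p - X).Monic := hpe ▸ Polynomial.monic_X_pow_add hlt
    have hdeg : (p - X).natDegree = d := by
      rw [hpe]
      exact Polynomial.natDegree_eq_of_degree_eq_some (by
        rw [Polynomial.degree_add_eq_left_of_degree_lt (by rwa [Polynomial.degree_X_pow]),
          Polynomial.degree_X_pow])
    obtain ⟨z, hz⟩ := exists_fin_map_eq (p - X).roots
      (by rw [← (IsAlgClosed.splits (p - X)).natDegree_eq_card_roots, hdeg])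
    have hnodal : p - X = Lagrange.nodal Finset.univ z := by
      rw [(IsAlgClosed.splits (p - X)).eq_prod_roots_of_monic hmonic, ← hz, Multiset.map_map]
      rfl
    have hfix : ∀ i, p.eval (z i) = z i := by
      intro i
      have : (p - X).eval (z i) = 0 := by
        rw [hnodal, Lagrange.eval_nodal_at_node (Finset.mem_univ i)]
      simpa [sub_eq_zero] using this
    have hder : ∀ i, ∏ j ∈ Finset.univ.erase i, (z i - z j) = (derivative p).eval (z i) - 1 := by
      intro i
      rw [← Lagrange.eval_nodal, ← Lagrange.eval_nodal_derivative_eval_node_eq (Finset.mem_univ i),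
        ← hnodal]
      simp
    refine Set.mem_biUnion (x := fun i => (derivative p).eval (z i)) (fun i => hpS _ (hfix i))
      ⟨z, ⟨fun i => hpS _ (hfix i), hder, ?_⟩, ?_⟩
    · have h := Polynomial.prod_X_sub_C_coeff_card_pred (Finset.univ : Finset (Fin d)) z
        (by simp; omega)
      have h' : (p - X).coeff (d - 1) = -∑ i, z i := by
        rw [hnodal, Lagrange.nodal_eq]
        simpa using h
      rw [hpe, Polynomial.coeff_add, Polynomial.coeff_sub, Polynomial.coeff_X_pow,
        if_neg (by omega), Polynomial.coeff_eq_zero_of_natDegree_lt (by omega : r.natDegree < d - 1),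
        zero_add, zero_sub, neg_inj] at h'
      exact h'.symm
    · simp only [← hnodal]; ring

end OneVariable

/-! ### Finiteness of normalized systems with given multipliers. -/

section Finiteness

variable {K : Type*} [Field K] {n d : ℕ}

/-- As a polynomial in `x_i`, the `i`-th polynomial is monic and centred. -/
def IsNormalized (d : ℕ) (g : Fin n → MvPolynomial (Fin n) K) : Prop :=
  ∀ i v, (slice v i (g i) - X ^ d).natDegree + 2 ≤ d

theorem finite_image_of_factors {α β γ : Type*} {A : Set α} {φ : α → β} {ψ : α → γ}
    (hφ : (φ '' A).Finite) (h : ∀ a ∈ A, ∀ b ∈ A, φ a = φ b → ψ a = ψ b) : (ψ '' A).Finite := by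
  rcases A.eq_empty_or_nonempty with rfl | ⟨a, -⟩
  · simp
  · have : Nonempty α := ⟨a⟩
    refine (hφ.image (ψ ∘ Function.invFunOn φ A)).subset ?_
    rintro _ ⟨b, hb, rfl⟩
    have hb' : φ b ∈ φ '' A := ⟨b, hb, rfl⟩
    exact ⟨φ b, hb', h _ (Function.invFunOn_mem hb') _ hb (Function.invFunOn_eq hb')⟩

/-- Induction on the number `k` of components retained. Once the first `k` are fixed, so are the
base points of the slices of the next one; there are finitely many slices over each base point, and
together they determine that component. -/
theorem finite_normalized_systems [IsAlgClosed K] [CharZero K] (hd : 2 ≤ d) {S : Set K}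
    (hfin : S.Finite) (hS : NoVanishingSum d S) :
    {g : Fin n → MvPolynomial (Fin n) K |
      IsTriSystem d g ∧ IsNormalized d g ∧ multipliers g ⊆ S}.Finite := by
  classical
  set A := {g : Fin n → MvPolynomial (Fin n) K |
      IsTriSystem d g ∧ IsNormalized d g ∧ multipliers g ⊆ S} with hA
  let T : ℕ → (Fin n → MvPolynomial (Fin n) K) → Fin n → MvPolynomial (Fin n) K :=
    fun k g i => if i.val < k then g i else 0
  have hT : ∀ {k g g'}, T k g = T k g' → ∀ i : Fin n, i.val < k → g i = g' i := by
    intro k g g' h i hi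
    simpa [T, hi] using congrFun h i
  have step : ∀ k, (T k '' A).Finite := by
    intro k
    induction k with
    | zero =>
      refine (Set.finite_singleton 0).subset ?_
      rintro _ ⟨g, -, rfl⟩
      exact funext fun i => if_neg (Nat.not_lt_zero _)
    | succ k ih =>
      by_cases hk : k < n
      · set i : Fin n := ⟨k, hk⟩
        refine (ih.biUnion (t := fun h => T (k + 1) '' {g ∈ A | T k g = h}) ?_).subset ?_
        · rintro _ ⟨g₀, hg₀, rfl⟩
          -- The base points depend only on the first `k` components, so they are common to the
          -- whole fibre of `T k`.
          set W := partialFixed g₀ k ∩ {v | ∀ i : Fin n, k ≤ i.val → v i = 0}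
          have hWfin : Finite W := (hg₀.1.finite_partialFixed hd k).to_subtype
          have hpart : ∀ g, T k g = T k g₀ → partialFixed g k = partialFixed g₀ k := by
            intro g hg
            ext v
            exact forall₂_congr fun l hl => by rw [hT hg l hl]
          refine finite_image_of_factors (φ := fun g (w : W) => slice w.1 i (g i)) ?_ ?_
          · refine (Set.Finite.pi' fun _ : W => finite_polynomials hd hfin hS).subset ?_
            rintro _ ⟨g, ⟨hg, hgT⟩, rfl⟩ w
            exact ⟨hg.2.1 i w.1, fun x hx => hg.2.2
              (hg.1.eval_derivative_slice_mem_multipliers hd (hpart g hgT ▸ w.2.1) hx)⟩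
          · rintro g ⟨hg, hgT⟩ g' ⟨hg', hgT'⟩ heq
            have hi : g i = g' i := by
              refine sub_eq_zero.mp (hg.1.eq_zero_of_isHomogeneous hd
                (fun h => hS.one_notMem hd (hg.2.2 h))
                ((hg.1.homogeneous i).sub (hg'.1.homogeneous i)) fun v hv => ?_)
              -- Truncating a fixed vector gives a base point in `W` over which the slice of `g i`
              -- is the same.
              let w : Fin n → K := fun l => if l.val < k then v l else 0
              have hwv : ∀ l : Fin n, l.val < k → w l = v l := fun l hl => if_pos hl
              have hw : w ∈ W := by
                refine ⟨hpart g hgT ▸ fun l hl => ?_, fun l hl => if_neg (by omega)⟩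
                rw [hwv l hl, ← hv l]
                exact hg.1.dependsOn l fun m hm => hwv m (lt_of_le_of_lt (Fin.le_def.mp hm) hl)
              have hsl := congrFun heq ⟨w, hw⟩
              simp only at hsl
              rw [slice_congr (hg.1.dependsOn i) (w := v) fun l hl => hwv l hl,
                slice_congr (hg'.1.dependsOn i) (w := v) fun l hl => hwv l hl] at hsl
              rw [map_sub, ← eval_slice_self v i, ← eval_slice_self v i, hsl, sub_self]
            funext l
            by_cases hl : l.val < k
            · simp only [T, Nat.lt_succ_of_lt hl, if_true]
              exact hT (hgT.trans hgT'.symm) l hl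
            · by_cases hl' : l = i
              · simp only [T, hl', hi]
              · have : ¬ l.val < k + 1 := fun h => hl' (Fin.ext (by simp only [i]; omega))
                simp only [T, this, if_false]
        · rintro _ ⟨g, hg, rfl⟩
          exact Set.mem_biUnion (x := T k g) ⟨g, hg, rfl⟩ ⟨g, ⟨hg, rfl⟩, rfl⟩
      · refine ih.subset ?_
        rintro _ ⟨g, hg, rfl⟩
        refine ⟨g, hg, funext fun l => ?_⟩
        have := l.isLt
        simp only [T, show l.val < k by omega, show l.val < k + 1 by omega, if_true]
  refine (step n).subset fun g hg => ⟨g, hg, funext fun l => if_pos l.isLt⟩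

end Finiteness

/-! ### Normalization by a lower triangular change of coordinates. -/

section Normalization

variable {K : Type*} [Field K]

theorem coeff_taylor_pred {c : ℕ} {p : K[X]} (hp : p.natDegree ≤ c + 1) (e : K) :
    (taylor e p).coeff c = p.coeff c + (c + 1 : ℕ) * p.coeff (c + 1) * e := by
  rw [taylor_coeff, Polynomial.eval_eq_sum_range' (n := 2)
    ((natDegree_hasseDeriv_le p c).trans_lt (by omega))]
  simp [Finset.sum_range_succ, hasseDeriv_coeff, add_comm 1 c, Nat.choose_succ_self_right]

/-- Rescaling by `t` turns the leading coefficient `a` into `t * a * t⁻¹ ^ d = 1`, and the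
translation by `e` kills the next coefficient. The constant `κ` is harmless, since `d - 1 > 0`. -/
theorem natDegree_comp_sub_X_pow {d : ℕ} (hd : 2 ≤ d) {p : K[X]} (hp : p.natDegree ≤ d) {t e κ : K}
    (ht : t ≠ 0) (ha : t ^ (d - 1) = p.coeff d) (he : p.coeff (d - 1) + d * p.coeff d * e = 0) :
    (C κ + C t * p.comp (C t⁻¹ * X + C e) - X ^ d).natDegree + 2 ≤ d := by
  obtain ⟨c, rfl⟩ : ∃ c, d = c + 2 := ⟨d - 2, by omega⟩
  have hcomp : p.comp (C t⁻¹ * X + C e) = (taylor e p).comp (C t⁻¹ * X) := by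
    rw [taylor_apply, Polynomial.comp_assoc]
    simp
  have hcoeff : ∀ k, 0 < k → (C κ + C t * p.comp (C t⁻¹ * X + C e) - X ^ (c + 2)).coeff k =
      t * ((taylor e p).coeff k * t⁻¹ ^ k) - if k = c + 2 then 1 else 0 := by
    intro k hk
    rw [Polynomial.coeff_sub, Polynomial.coeff_add, Polynomial.coeff_C_of_ne_zero hk.ne',
      Polynomial.coeff_C_mul, hcomp, comp_C_mul_X_coeff, Polynomial.coeff_X_pow, zero_add]
  refine Nat.add_le_add_right (Polynomial.natDegree_le_iff_coeff_eq_zero.mpr fun k hk => ?_) 2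
  rw [hcoeff k (by omega)]
  rcases lt_trichotomy k (c + 2) with h | rfl | h
  · obtain rfl : k = c + 1 := by omega
    rw [coeff_taylor_pred hp, if_neg (by omega)]
    have : c + 2 - 1 = c + 1 := rfl
    rw [this] at he
    rw [show c + 1 + 1 = c + 2 from rfl, he]
    simp
  · have h1 : (taylor e p).coeff (c + 2) = p.coeff (c + 2) := by
      rw [taylor_coeff, Polynomial.eval_eq_sum_range' (n := 1)
        ((natDegree_hasseDeriv_le p _).trans_lt (by omega))]
      simp [hasseDeriv_coeff]
    rw [h1, ← ha, if_pos rfl, show c + 2 - 1 = c + 1 from rfl]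
    rw [inv_pow, ← mul_assoc, ← pow_succ', mul_inv_cancel₀ (pow_ne_zero _ ht), sub_self]
  · rw [if_neg (by omega), Polynomial.coeff_eq_zero_of_natDegree_lt
      (by rw [natDegree_taylor]; omega)]
    simp

theorem eval_aeval {n : ℕ} (v : Fin n → K) (u : Fin n → MvPolynomial (Fin n) K)
    (p : MvPolynomial (Fin n) K) : MvPolynomial.eval v (MvPolynomial.aeval u p) =
      MvPolynomial.eval (fun l => MvPolynomial.eval v (u l)) p := by
  have h : (MvPolynomial.aeval v).comp (MvPolynomial.aeval u) =
      MvPolynomial.aeval (R := K) (fun l => MvPolynomial.eval v (u l)) :=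
    MvPolynomial.algHom_ext fun l => by simp [MvPolynomial.aeval_eq_eval]
  simpa [MvPolynomial.aeval_eq_eval] using DFunLike.congr_fun h p

variable {N d : ℕ}

/-- The conjugate of an endomorphism by a linear change of coordinates. -/
noncomputable def Endo.conj (f : Endo K N d) (A : GL (Fin (N + 1)) K) : Endo K N d where
  poly i := ∑ k, MvPolynomial.C ((A⁻¹ : GL (Fin (N + 1)) K).val i k) *
    MvPolynomial.aeval (fun l => ∑ m, MvPolynomial.C (A.val l m) * MvPolynomial.X m) (f.poly k)
  homogeneous i := by
    refine MvPolynomial.IsHomogeneous.sum _ _ _ fun k _ => ?_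
    have h := (f.homogeneous k).aeval
      (fun l => ∑ m : Fin (N + 1), MvPolynomial.C (A.val l m) * MvPolynomial.X m)
      (n := 1) fun l => MvPolynomial.IsHomogeneous.sum _ _ _ fun m _ => by
        simpa using (MvPolynomial.isHomogeneous_C _ (A.val l m)).mul
          (MvPolynomial.isHomogeneous_X K m)
    rw [one_mul] at h
    simpa using (MvPolynomial.isHomogeneous_C _ ((A⁻¹ : GL (Fin (N + 1)) K).val i k)).mul h
  eq_zero_of_eval v hv := by
    have key : (A⁻¹ : GL (Fin (N + 1)) K).val.mulVec (f.toFun (A.val.mulVec v)) = 0 := by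
      funext i
      rw [Pi.zero_apply, ← hv i, map_sum]
      refine Finset.sum_congr (s₂ := (Finset.univ : Finset (Fin (N + 1)))) rfl fun k _ => ?_
      rw [map_mul, MvPolynomial.eval_C]
      congr 1
      rw [Endo.toFun, eval_aeval]
      simp only [map_sum, map_mul, MvPolynomial.eval_C, MvPolynomial.eval_X]
      rfl
    have h1 := congrArg A.val.mulVec key
    rw [Matrix.mulVec_mulVec, ← Units.val_mul, mul_inv_cancel, Units.val_one, Matrix.one_mulVec,
      Matrix.mulVec_zero] at h1
    have h2 := f.eq_zero_of_eval _ fun i => congrFun h1 i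
    have h3 := congrArg (A⁻¹ : GL (Fin (N + 1)) K).val.mulVec h2
    rwa [Matrix.mulVec_mulVec, ← Units.val_mul, inv_mul_cancel, Units.val_one, Matrix.one_mulVec,
      Matrix.mulVec_zero] at h3

theorem Endo.toFun_conj (f : Endo K N d) (A : GL (Fin (N + 1)) K) (v : Fin (N + 1) → K) :
    (f.conj A).toFun v = (A⁻¹ : GL (Fin (N + 1)) K).val.mulVec (f.toFun (A.val.mulVec v)) := by
  funext i
  rw [Endo.toFun, Endo.conj, map_sum]
  refine Finset.sum_congr (s₂ := Finset.univ) rfl fun k _ => ?_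
  rw [map_mul, MvPolynomial.eval_C]
  congr 1
  rw [Endo.toFun, eval_aeval]
  simp only [map_sum, map_mul, MvPolynomial.eval_C, MvPolynomial.eval_X]
  rfl

theorem Endo.isConj_conj (f : Endo K N d) (A : GL (Fin (N + 1)) K) : f.IsConj (f.conj A) :=
  ⟨A, 1, fun v => by rw [f.toFun_conj, Units.val_one, one_smul]⟩

/-- The second coefficient of `f_i` in `x_i` is, by homogeneity, a linear form in the earlier
variables. The centring translation is therefore linear, so that it can be carried out within the
projective linear group. -/
theorem exists_isConj_isNormalized [IsAlgClosed K] [CharZero K] (hd : 2 ≤ d) (f : Endo K N d)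
    (hf : IsTriSystem d f.poly) :
    ∃ g : Endo K N d, f.IsConj g ∧ IsTriSystem d g.poly ∧ IsNormalized d g.poly ∧
      multipliers g.poly ⊆ multipliers f.poly := by
  classical
  set a : Fin (N + 1) → K := fun i => (f.poly i).coeff (Finsupp.single i d) with ha
  have ha0 : ∀ i, a i ≠ 0 := hf.coeff_ne_zero
  have hd0 : (d : K) ≠ 0 := by exact_mod_cast (by omega : d ≠ 0)
  obtain ⟨L, hL0, hL⟩ : ∃ L : Fin (N + 1) → Fin (N + 1) → K, (∀ i l, i ≤ l → L i l = 0) ∧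
      ∀ i v, (slice v i (f.poly i)).coeff (d - 1) = ∑ l, L i l * v l := by
    obtain ⟨c, rfl⟩ : ∃ c, d = c + 1 := ⟨d - 1, by omega⟩
    choose L hL using fun i => exists_coeff_slice_eq_sum i (f.homogeneous i)
    refine ⟨fun i l => if l < i then L i l else 0, fun i l h => if_neg (not_lt.mpr h),
      fun i v => ?_⟩
    -- The slice ignores the coordinates from `i` on, so the linear form may be truncated to those
    -- before `i`.
    rw [slice_congr (hf.dependsOn i) (w := fun l => if l < i then v l else 0)
      fun l hl => (if_pos hl).symm, Nat.add_sub_cancel, hL]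
    exact Finset.sum_congr rfl fun l _ => by by_cases h : l < i <;> simp [h]
  choose t ht using fun i => IsAlgClosed.exists_pow_nat_eq (a i) (show 0 < d - 1 by omega)
  have ht0 : ∀ i, t i ≠ 0 := fun i h => ha0 i (by rw [← ht, h, zero_pow (by omega)])
  -- The new coordinates are `t_i * (x_i + L_i(x) / (d * a_i))`: the centre of the slice is moved to
  -- zero and its leading coefficient scaled to `1`.
  let B : Matrix (Fin (N + 1)) (Fin (N + 1)) K :=
    Matrix.of fun i l => t i * ((if i = l then 1 else 0) + L i l / (d * a i))
  have hBlt : ∀ i l, i < l → B i l = 0 := fun i l h => by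
    simp [B, hL0 i l h.le, h.ne]
  have hBdiag : ∀ i, B i i = t i := fun i => by simp [B, hL0 i i le_rfl]
  have hdet : B.det ≠ 0 := by
    rw [Matrix.det_of_isLowerTriangular B (fun i l h => hBlt i l h)]
    exact Finset.prod_ne_zero_iff.mpr fun i _ => by rw [hBdiag]; exact ht0 i
  let U : GL (Fin (N + 1)) K := Matrix.GeneralLinearGroup.mkOfDetNeZero B hdet
  have hU : U.val = B := rfl
  let A := U⁻¹.val
  have hBA : ∀ v, B.mulVec (A.mulVec v) = v := fun v => by
    rw [Matrix.mulVec_mulVec, ← hU, ← Units.val_mul, mul_inv_cancel, Units.val_one,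
      Matrix.one_mulVec]
  have hAB : ∀ v, A.mulVec (B.mulVec v) = v := fun v => by
    rw [Matrix.mulVec_mulVec, ← hU, ← Units.val_mul, inv_mul_cancel, Units.val_one,
      Matrix.one_mulVec]
  have hrec : ∀ v i, A.mulVec v i =
      (t i)⁻¹ * v i + -(∑ l, L i l * A.mulVec v l) / (d * a i) := by
    intro v i
    have h : v i = t i * (A.mulVec v i + (∑ l, L i l * A.mulVec v l) / (d * a i)) := by
      conv_lhs => rw [← hBA v]
      have hB : ∀ l, B i l * A.mulVec v l = (if i = l then t i * A.mulVec v l else 0) +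
          t i * (L i l * A.mulVec v l / (d * a i)) := fun l => by
        by_cases h : i = l
        · simp only [B, Matrix.of_apply, h, if_true]; ring
        · simp only [B, Matrix.of_apply, h, if_false]; ring
      have hsum : B.mulVec (A.mulVec v) i = ∑ l, B i l * A.mulVec v l := rfl
      rw [hsum, Finset.sum_congr rfl fun l _ => hB l, Finset.sum_add_distrib, Finset.sum_ite_eq,
        if_pos (Finset.mem_univ i), ← Finset.mul_sum, ← Finset.sum_div, mul_add]
    rw [h, inv_mul_cancel_left₀ (ht0 i)]
    ring
  have hAcongr : ∀ (j : Fin (N + 1)) v w, (∀ l ≤ j, v l = w l) → A.mulVec v j = A.mulVec w j := by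
    intro j
    induction j using WellFoundedLT.induction with
    | ind j ih =>
      intro v w h
      rw [hrec, hrec w, h j le_rfl]
      congr 3
      refine Finset.sum_congr rfl fun l _ => ?_
      rcases lt_or_ge l j with hl | hl
      · rw [ih l hl v w fun m hm => h m (hm.trans hl.le)]
      · rw [hL0 j l hl, zero_mul, zero_mul]
  have hfun : ∀ v i, MvPolynomial.eval v ((f.conj U⁻¹).poly i) =
      ∑ k, B i k * MvPolynomial.eval (A.mulVec v) (f.poly k) := by
    intro v i
    have h := congrFun (f.toFun_conj U⁻¹ v) i
    rw [inv_inv] at h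
    exact h
  have hslice : ∀ v i, ∃ κ, slice v i ((f.conj U⁻¹).poly i) = C κ + C (t i) *
      (slice (A.mulVec v) i (f.poly i)).comp (C (t i)⁻¹ * X +
        C (-(∑ l, L i l * A.mulVec v l) / (d * a i))) := by
    intro v i
    -- The components before `i` do not involve `x_i` and contribute a constant; those after `i`
    -- have coefficient zero in row `i` of `B`.
    refine ⟨∑ k ∈ Finset.univ.erase i, B i k * MvPolynomial.eval (A.mulVec v) (f.poly k),
      Polynomial.funext fun y => ?_⟩
    have hlt : ∀ l < i, A.mulVec (Function.update v i y) l = A.mulVec v l := fun l hl =>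
      hAcongr l _ _ fun m hm => Function.update_of_ne (hm.trans_lt hl).ne _ _
    have hi : A.mulVec (Function.update v i y) i =
        (t i)⁻¹ * y + -(∑ l, L i l * A.mulVec v l) / (d * a i) := by
      rw [hrec, Function.update_self]
      congr 3
      refine Finset.sum_congr rfl fun l _ => ?_
      rcases lt_or_ge l i with hl | hl
      · rw [hlt l hl]
      · rw [hL0 i l hl, zero_mul, zero_mul]
    rw [eval_slice, hfun, ← Finset.sum_erase_add _ _ (Finset.mem_univ i), hBdiag]
    simp only [eval_add, eval_mul, eval_C, eval_comp, eval_X]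
    rw [eval_slice, ← hi]
    congr 1
    · refine Finset.sum_congr rfl fun k hk => ?_
      rcases lt_or_gt_of_ne (Finset.ne_of_mem_erase hk) with h | h
      · congr 1
        exact hf.dependsOn k fun l hl => hlt l ((Set.mem_Iic.mp hl).trans_lt h)
      · rw [hBlt i k h, zero_mul, zero_mul]
    · congr 1
      refine hf.dependsOn i fun l hl => ?_
      rcases eq_or_lt_of_le (Set.mem_Iic.mp hl) with rfl | hl
      · rw [Function.update_self]
      · rw [Function.update_of_ne hl.ne, hlt l hl]
  have hnorm : IsNormalized d (f.conj U⁻¹).poly := by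
    intro i v
    obtain ⟨κ, hκ⟩ := hslice v i
    rw [hκ]
    refine natDegree_comp_sub_X_pow hd (natDegree_slice_le_of_isHomogeneous _ _ (f.homogeneous i))
      (ht0 i) ?_ ?_
    · rw [coeff_slice_top _ _ (f.homogeneous i), ht]
    · rw [coeff_slice_top _ _ (f.homogeneous i), hL]
      have := ha0 i
      simp only [ha] at this ⊢
      field_simp
      ring
  refine ⟨f.conj U⁻¹, f.isConj_conj _, ⟨Endo.homogeneous _, fun i v w h => ?_, fun i => ?_⟩,
    hnorm, ?_⟩
  · simp only [hfun]
    refine Finset.sum_congr rfl fun k _ => ?_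
    rcases le_or_gt k i with hk | hk
    · congr 1
      refine hf.dependsOn k fun l hl => hAcongr l _ _ fun m hm => h m ?_
      exact (hm.trans (Set.mem_Iic.mp hl)).trans hk
    · rw [hBlt i k hk, zero_mul, zero_mul]
  · have h := hnorm i 0
    rw [← coeff_slice_top 0 i (Endo.homogeneous _ i)]
    intro h0
    have h1 := Polynomial.coeff_eq_zero_of_natDegree_lt
      (show (slice 0 i ((f.conj U⁻¹).poly i) - X ^ d).natDegree < d by omega)
    rw [Polynomial.coeff_sub, h0, Polynomial.coeff_X_pow_self] at h1
    simp at h1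
  · rintro _ ⟨v, hv, i, rfl⟩
    -- Conjugation carries fixed vectors to fixed vectors, and in the chain rule for the slice the
    -- factors `t i` and `(t i)⁻¹` cancel.
    refine ⟨A.mulVec v, fun k => ?_, i, ?_⟩
    · have h : B.mulVec (f.toFun (A.mulVec v)) = v := funext fun i => (hfun v i).symm.trans (hv i)
      have h2 := congrArg A.mulVec h
      rw [hAB] at h2
      exact congrFun h2 k
    · obtain ⟨κ, hκ⟩ := hslice v i
      rw [← eval_derivative_slice v i, hκ, ← eval_derivative_slice, hrec v i]
      simp [derivative_comp]
      field_simp [ht0 i]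

end Normalization

/-! ### Triangular endomorphisms: fixed points, fixed vectors and multipliers. -/

section TriangularEndo

variable {K : Type*} [Field K] {n d : ℕ}

theorem eval_smul_of_isHomogeneous {p : MvPolynomial (Fin n) K} (hp : p.IsHomogeneous d) (s : K)
    (v : Fin n → K) : MvPolynomial.eval (s • v) p = s ^ d * MvPolynomial.eval v p := by
  rw [MvPolynomial.eval_eq', MvPolynomial.eval_eq', Finset.mul_sum]
  refine Finset.sum_congr rfl fun m hm => ?_
  have h := degree_of_mem_support hp hm
  rw [Finsupp.degree_eq_sum] at h
  simp only [Pi.smul_apply, smul_eq_mul, mul_pow]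
  rw [Finset.prod_mul_distrib, Finset.prod_pow_eq_pow_sum, h]
  ring

theorem slice_zero_of_isHomogeneous {p : MvPolynomial (Fin n) K} (hp : p.IsHomogeneous d)
    (i : Fin n) : slice 0 i p = C (p.coeff (Finsupp.single i d)) * X ^ d := by
  rw [slice_eq_sum, Finset.sum_eq_single (Finsupp.single i d)]
  · rw [Finset.prod_eq_one, mul_one, Finsupp.single_eq_same]
    intro l hl
    rw [Finsupp.single_eq_of_ne (Finset.ne_of_mem_erase hl), pow_zero]
  · intro m hm hne
    obtain ⟨l, hl, hml⟩ : ∃ l ∈ Finset.univ.erase i, m l ≠ 0 := by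
      by_contra! hcon
      have h := degree_of_mem_support hp hm
      rw [Finsupp.degree_eq_sum, ← Finset.add_sum_erase _ _ (Finset.mem_univ i),
        Finset.sum_eq_zero hcon, add_zero] at h
      apply hne
      ext l
      by_cases hl : l = i
      · rw [hl, h, Finsupp.single_eq_same]
      · rw [Finsupp.single_eq_of_ne hl, hcon l (Finset.mem_erase.mpr ⟨hl, Finset.mem_univ _⟩)]
    rw [Finset.prod_eq_zero hl (by simp [hml]), mul_zero, map_zero, zero_mul]
  · intro h
    simp [MvPolynomial.notMem_support_iff.mp h]

theorem IsTriangular.dependsOn {g : Fin n → MvPolynomial (Fin n) K} (hg : IsTriangular g)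
    (i : Fin n) : DependsOn (fun v => MvPolynomial.eval v (g i)) (Set.Iic i) := by
  intro v w h
  refine MvPolynomial.eval₂Hom_congr' rfl (fun j hj _ => h j (hg i j hj)) rfl

variable {N : ℕ}

/-- If a diagonal coefficient vanished, take the last such index `i`. The vector with `x_i = 1` and
zeros before it kills the first equations up to `i`, and extends to a nonzero common zero of all of
them. -/
theorem Endo.isTriSystem [IsAlgClosed K] (hd : 2 ≤ d) {f : Endo K N d} (hf : IsTriangular f.poly) :
    IsTriSystem d f.poly := by
  refine ⟨f.homogeneous, hf.dependsOn, ?_⟩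
  by_contra! hcon
  obtain ⟨i, hi, hmax⟩ := Set.Finite.exists_maximal (Set.toFinite
    {i | (f.poly i).coeff (Finsupp.single i d) = 0}) hcon
  obtain ⟨w, hw1, hw2⟩ := exists_extension hd f.homogeneous hf.dependsOn (i + 1)
    (fun l hl h => by
      have h1 := hmax h (show i ≤ l from Fin.le_def.mpr (by omega))
      have h2 := Fin.le_def.mp h1
      omega) (Function.update 0 i 1) 0
  have hle : ∀ l ≤ i, w l = Function.update (0 : Fin (N + 1) → K) i 1 l := fun l hl =>
    hw1 l (Nat.lt_succ_of_le (Fin.le_def.mp hl))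
  have hw0 := f.eq_zero_of_eval w fun l => ?_
  · have := hle i le_rfl
    rw [hw0] at this
    simp at this
  · rcases le_or_gt l i with hl | hl
    · have h := hf.dependsOn l (x := w) (y := Function.update (0 : Fin (N + 1) → K) i 1)
        fun m hm => hle m ((Set.mem_Iic.mp hm).trans hl)
      simp only at h
      rw [h]
      rcases eq_or_lt_of_le hl with rfl | hl
      · rw [← eval_slice, slice_zero_of_isHomogeneous (f.homogeneous _), hi]
        simp
      · have h := hf.dependsOn l (x := Function.update (0 : Fin (N + 1) → K) i 1)
          (y := (0 : K) • 0) fun m hm => by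
            rw [Function.update_of_ne ((Set.mem_Iic.mp hm).trans_lt hl).ne]
            simp
        simp only at h
        rw [h, eval_smul_of_isHomogeneous (f.homogeneous l), zero_pow (by omega), zero_mul]
    · rw [hw2 l (Nat.succ_le_of_lt (Fin.lt_def.mp hl)), zero_mul]

theorem coords_chart (P : ℙ K (Fin (N + 1) → K)) : coords P (chart P) = 1 := by
  classical
  have h : P.rep (chart P) ≠ 0 := Fin.find_spec (exists_rep_ne_zero P)
  simp [coords, h]

theorem coords_of_lt_chart (P : ℙ K (Fin (N + 1) → K)) {l : Fin (N + 1)} (h : l < chart P) :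
    coords P l = 0 := by
  classical
  have h : ¬ P.rep l ≠ 0 := Fin.find_min (exists_rep_ne_zero P) h
  simp only [ne_eq, not_not] at h
  simp [coords, h]

theorem coords_ne_zero (P : ℙ K (Fin (N + 1) → K)) : coords P ≠ 0 := fun h => by
  have := coords_chart P
  rw [h] at this
  simp at this

theorem exists_coords_eq_smul (v : Fin (N + 1) → K) (hv : v ≠ 0) :
    ∃ s : K, s ≠ 0 ∧ v = s • coords (Projectivization.mk K v hv) := by
  obtain ⟨a, ha⟩ := Projectivization.exists_smul_eq_mk_rep K v hv
  set P := Projectivization.mk K v hv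
  have h : P.rep (chart P) ≠ 0 := by
    classical
    exact Fin.find_spec (exists_rep_ne_zero P)
  refine ⟨(a : K)⁻¹ * P.rep (chart P), mul_ne_zero (inv_ne_zero a.ne_zero) h, ?_⟩
  rw [coords, smul_smul, mul_assoc, mul_inv_cancel₀ h, mul_one, ← ha, Units.smul_def, smul_smul,
    inv_mul_cancel₀ a.ne_zero, one_smul]

theorem Endo.toFun_smul (f : Endo K N d) (s : K) (v : Fin (N + 1) → K) :
    f.toFun (s • v) = s ^ d • f.toFun v :=
  funext fun i => eval_smul_of_isHomogeneous (f.homogeneous i) s v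

/-- If `f y = c • y`, then a suitable multiple of `y` is a fixed vector. -/
theorem Endo.exists_smul_mem_fixedVectors [IsAlgClosed K] (hd : 2 ≤ d) (f : Endo K N d) {y : Fin (N + 1) → K}
    (hy : y ≠ 0) {c : K} (h : f.toFun y = c • y) :
    ∃ s : K, s ≠ 0 ∧ s • y ∈ fixedVectors f.poly := by
  have hc : c ≠ 0 := by
    rintro rfl
    exact hy (f.eq_zero_of_eval y fun i => (congrFun h i).trans (by simp))
  obtain ⟨s, hs⟩ := IsAlgClosed.exists_pow_nat_eq c⁻¹ (show 0 < d - 1 by omega)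
  refine ⟨s, fun h0 => inv_ne_zero hc (by rw [← hs, h0, zero_pow (by omega)]), fun i => ?_⟩
  have := congrFun (f.toFun_smul s y) i
  have hsd : s ^ d = c⁻¹ * s := by rw [← hs, ← pow_succ, Nat.sub_add_cancel (by omega)]
  rw [h, hsd, smul_smul, mul_right_comm, inv_mul_cancel₀ hc, one_mul] at this
  exact this

theorem Endo.toFun_coords (f : Endo K N d) {P : ℙ K (Fin (N + 1) → K)} (hP : P ∈ f.fixedPoints) :
    f.toFun (coords P) = f.toFun (coords P) (chart P) • coords P := by
  obtain ⟨c, hc⟩ := hP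
  obtain ⟨c', hc'⟩ : ∃ c', f.toFun (coords P) = c' • coords P := by
    refine ⟨(P.rep (chart P))⁻¹ ^ (d) * c * P.rep (chart P), ?_⟩
    have h : P.rep (chart P) ≠ 0 := by
      classical
      exact Fin.find_spec (exists_rep_ne_zero P)
    rw [coords, f.toFun_smul, hc, smul_smul, smul_smul, mul_assoc _ (P.rep (chart P)),
      mul_inv_cancel₀ h, mul_one]
  have h1 : f.toFun (coords P) (chart P) = c' := by
    rw [hc', Pi.smul_apply, coords_chart, smul_eq_mul, mul_one]
  rw [h1, hc']

theorem Endo.exists_fixedPoint (f : Endo K N d) {v : Fin (N + 1) → K}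
    (hv : v ∈ fixedVectors f.poly) (hv0 : v ≠ 0) :
    ∃ P ∈ f.fixedPoints, ∃ s : K, s ≠ 0 ∧ v = s • coords P := by
  refine ⟨Projectivization.mk K v hv0, ?_, exists_coords_eq_smul v hv0⟩
  obtain ⟨a, ha⟩ := Projectivization.exists_smul_eq_mk_rep K v hv0
  refine ⟨a ^ d * (a : K)⁻¹, ?_⟩
  have hfv : f.toFun v = v := funext hv
  rw [← ha, Units.smul_def, f.toFun_smul, hfv, smul_smul, mul_assoc, inv_mul_cancel₀ a.ne_zero,
    mul_one]

theorem Endo.exists_fixedVector [IsAlgClosed K] (hd : 2 ≤ d) (f : Endo K N d) {P : ℙ K (Fin (N + 1) → K)}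
    (hP : P ∈ f.fixedPoints) : ∃ s : K, s ≠ 0 ∧ s • coords P ∈ fixedVectors f.poly :=
  f.exists_smul_mem_fixedVectors hd (coords_ne_zero P) (f.toFun_coords hP)

theorem Endo.finite_fixedPoints [IsAlgClosed K] (hd : 2 ≤ d) {f : Endo K N d}
    (hf : IsTriangular f.poly) : f.fixedPoints.Finite := by
  have hfin := (Endo.isTriSystem hd hf).finite_fixedVectors hd
  have : Finite {v // v ∈ fixedVectors f.poly ∧ v ≠ 0} :=
    (hfin.subset fun v hv => hv.1 : {v | v ∈ fixedVectors f.poly ∧ v ≠ 0}.Finite).to_subtype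
  refine (Set.finite_range fun v : {v // v ∈ fixedVectors f.poly ∧ v ≠ 0} =>
    Projectivization.mk K v.1 v.2.2).subset fun P hP => ?_
  obtain ⟨s, hs, hv⟩ := f.exists_fixedVector hd hP
  refine ⟨⟨_, hv, smul_ne_zero hs (coords_ne_zero P)⟩, ?_⟩
  conv_rhs => rw [← P.mk_rep]
  rw [Projectivization.mk_eq_mk_iff']
  exact ⟨s * (P.rep (chart P))⁻¹, by rw [← smul_smul]; rfl⟩

/-- In the chart of the first nonzero coordinate the Jacobian matrix is lower triangular. Passing
from `coords P` to the fixed vector `s • coords P` scales the partial derivatives by `s ^ (d - 1)`,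
which is exactly the inverse of the eigenvalue `c` dividing the affine Jacobian. -/
theorem Endo.multiplierPoly_eq_prod {f : Endo K N d} (hf : IsTriangular f.poly) (hd : 2 ≤ d)
    {P : ℙ K (Fin (N + 1) → K)} (hP : P ∈ f.fixedPoints) {s : K} (hs : s ≠ 0)
    (hv : s • coords P ∈ fixedVectors f.poly) :
    f.multiplierPoly P = ∏ i : {i // i ≠ chart P},
      (X - C (MvPolynomial.eval (s • coords P) (MvPolynomial.pderiv i.1 (f.poly i.1)))) := by
  classical
  set y := coords P with hy
  set c := f.toFun y (chart P) with hc
  have hfy : ∀ i, MvPolynomial.eval y (f.poly i) = c * y i := congrFun (f.toFun_coords hP)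
  have hcs : c * s ^ (d - 1) = 1 := by
    have h := hv (chart P)
    rw [eval_smul_of_isHomogeneous (f.homogeneous _), hfy, Pi.smul_apply, smul_eq_mul, hy,
      coords_chart, mul_one, mul_one, ← Nat.sub_add_cancel (by omega : 1 ≤ d), pow_succ,
      mul_right_comm] at h
    rw [mul_comm]
    exact mul_right_cancel₀ hs (h.trans (one_mul s).symm)
  have hc0 : c ≠ 0 := left_ne_zero_of_mul_eq_one hcs
  have hpd : ∀ i k : Fin (N + 1), i < k → MvPolynomial.pderiv k (f.poly i) = 0 := fun i k h =>
    MvPolynomial.pderiv_eq_zero_of_notMem_vars fun hk => absurd (hf i k hk) (not_le.mpr h)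
  -- The correction term of the quotient rule: coordinates before the chart index vanish at `P`, and
  -- `f_j` for the chart index `j` does not involve later variables.
  have hsecond : ∀ i k : Fin (N + 1), i ≠ chart P → i ≤ k → MvPolynomial.eval y (f.poly i) *
      MvPolynomial.eval y (MvPolynomial.pderiv k (f.poly (chart P))) = 0 := by
    intro i k hi hik
    rcases lt_or_gt_of_ne hi with h | h
    · rw [hfy, hy, coords_of_lt_chart P h, mul_zero, zero_mul]
    · rw [hpd _ k (h.trans_le hik), map_zero, mul_zero]
  have hlower : (f.multiplierMatrix P).transpose.IsUpperTriangular := by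
    intro k i hik
    have hik : (i : Fin (N + 1)) < k := hik
    simp only [Matrix.transpose_apply, multiplierMatrix, Matrix.of_apply, ← hy]
    rw [hsecond i k i.2 hik.le, hpd _ _ hik]
    simp
  rw [multiplierPoly, ← Matrix.charpoly_transpose]
  convert! Matrix.charpoly_of_isUpperTriangular _ hlower using 2 with i
  congr 2
  simp only [Matrix.transpose_apply, multiplierMatrix, Matrix.of_apply, ← hy]
  rw [hsecond i i i.2 le_rfl, eval_smul_of_isHomogeneous (f.homogeneous _).pderiv, sub_zero,
    hfy (chart P), hy, coords_chart, mul_one, eq_div_iff (pow_ne_zero 2 hc0)]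
  calc _ = MvPolynomial.eval (coords P) (MvPolynomial.pderiv i.1 (f.poly i.1)) * c *
      (c * s ^ (d - 1)) := by ring
    _ = _ := by rw [hcs, mul_one]

/-- The multiplier in the direction of a fixed vector is `d`. -/
theorem IsTriSystem.eval_pderiv_first [Infinite K] {g : Fin n → MvPolynomial (Fin n) K}
    (hd : 2 ≤ d) (hg : IsTriSystem d g) {v : Fin n → K} (hv : v ∈ fixedVectors g) {i : Fin n}
    (hi : v i ≠ 0) (hlt : ∀ l < i, v l = 0) :
    MvPolynomial.eval v (MvPolynomial.pderiv i (g i)) = d := by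
  have hs : slice v i (g i) = C ((g i).coeff (Finsupp.single i d)) * X ^ d := by
    rw [← slice_zero_of_isHomogeneous (hg.homogeneous i)]
    exact slice_congr (hg.dependsOn i) hlt
  have h := hv i
  rw [← eval_slice_self v i, hs] at h
  simp only [eval_mul, eval_C, eval_pow, eval_X] at h
  rw [← Nat.sub_add_cancel (by omega : 1 ≤ d), pow_succ, ← mul_assoc] at h
  have h1 := mul_right_cancel₀ hi (h.trans (one_mul _).symm)
  rw [← eval_derivative_slice, hs]
  simp only [derivative_mul, derivative_C, zero_mul, zero_add, derivative_X_pow, eval_mul, eval_C,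
    eval_pow, eval_X]
  rw [Nat.sub_add_cancel (by omega : 1 ≤ d)] at h1
  rw [mul_left_comm, h1, mul_one]

/-- The last axis is invariant, since all other components vanish on it, and it carries a nonzero
fixed vector. -/
theorem IsTriSystem.degree_mem_multipliers [IsAlgClosed K] (hd : 2 ≤ d)
    {g : Fin (N + 1) → MvPolynomial (Fin (N + 1)) K} (hg : IsTriSystem d g) :
    (d : K) ∈ multipliers g := by
  set a := (g (Fin.last N)).coeff (Finsupp.single (Fin.last N) d)
  obtain ⟨x, hx⟩ := IsAlgClosed.exists_pow_nat_eq a⁻¹ (show 0 < d - 1 by omega)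
  have ha : a ≠ 0 := hg.coeff_ne_zero _
  have hx0 : x ≠ 0 := fun h => inv_ne_zero ha (by rw [← hx, h, zero_pow (by omega)])
  have hv : Function.update (0 : Fin (N + 1) → K) (Fin.last N) x ∈ fixedVectors g := by
    intro i
    rcases eq_or_lt_of_le (Fin.le_last i) with rfl | hi
    · rw [← eval_slice, slice_zero_of_isHomogeneous (hg.homogeneous _), Function.update_self]
      simp only [eval_mul, eval_C, eval_pow, eval_X]
      rw [show x ^ d = a⁻¹ * x by rw [← hx, ← pow_succ, Nat.sub_add_cancel (by omega)],
        ← mul_assoc, mul_inv_cancel₀ ha, one_mul]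
    · have h := hg.dependsOn i (x := Function.update (0 : Fin (N + 1) → K) (Fin.last N) x)
        (y := (0 : K) • 0) fun m hm => by
          rw [Function.update_of_ne ((Set.mem_Iic.mp hm).trans_lt hi).ne]
          simp
      simp only at h
      rw [h, eval_smul_of_isHomogeneous (hg.homogeneous i), zero_pow (by omega), zero_mul,
        Function.update_of_ne hi.ne, Pi.zero_apply]
  refine ⟨_, hv, Fin.last N, hg.eval_pderiv_first hd hv (by simpa using hx0) fun l hl => ?_⟩
  rw [Function.update_of_ne hl.ne, Pi.zero_apply]

theorem IsTriSystem.eval_zero_pderiv (hd : 2 ≤ d) {g : Fin n → MvPolynomial (Fin n) K}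
    (hg : IsTriSystem d g) (i : Fin n) :
    MvPolynomial.eval 0 (MvPolynomial.pderiv i (g i)) = 0 := by
  have h := eval_smul_of_isHomogeneous ((hg.homogeneous i).pderiv (i := i)) 0 0
  rwa [smul_zero, zero_pow (by omega), zero_mul] at h

theorem IsTriSystem.zero_mem_fixedVectors (hd : 2 ≤ d) {g : Fin n → MvPolynomial (Fin n) K}
    (hg : IsTriSystem d g) : 0 ∈ fixedVectors g := by
  intro i
  have h := eval_smul_of_isHomogeneous (hg.homogeneous i) 0 0
  rwa [smul_zero, zero_pow (by omega), zero_mul] at h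

/-! ### Nonvanishing of the fixed point multiplicities. -/

section Multiplicity

/-- In an Artinian ring the powers of `s` stabilize, `s ^ k = s ^ (k + 1) * t`, so the inverse of `φ
s` is already `φ t`. Thus a localization of an Artinian ring is a quotient of it. -/
theorem surjective_of_isUnit {B A : Type*} [CommRing B] [IsArtinianRing B] [CommRing A]
    (φ : B →+* A) (h : ∀ a, ∃ r s, IsUnit (φ s) ∧ a * φ s = φ r) : Function.Surjective φ := by
  intro a
  obtain ⟨r, s, hs, ha⟩ := h a
  obtain ⟨k, t, ht⟩ := IsArtinian.exists_pow_succ_smul_dvd s (1 : B)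
  simp only [smul_eq_mul, mul_one] at ht
  have h1 : φ s * φ t = 1 := by
    have h2 := congrArg φ ht
    rw [map_mul, map_pow, map_pow, pow_succ, mul_assoc] at h2
    exact (hs.pow k).mul_left_cancel (h2.trans (mul_one _).symm)
  exact ⟨r * t, by rw [map_mul, ← ha, mul_assoc, h1, mul_one]⟩

theorem isIntegral_of_surjective {R A σ : Type*} [CommRing R] [CommRing A] [Algebra R A]
    (φ : MvPolynomial σ R →ₐ[R] A) (hφ : Function.Surjective φ)
    (h : ∀ l, IsIntegral R (φ (MvPolynomial.X l))) : Algebra.IsIntegral R A := by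
  refine ⟨fun x => ?_⟩
  obtain ⟨p, rfl⟩ := hφ x
  induction p using MvPolynomial.induction_on with
  | C a => exact (φ.commutes a).symm ▸ isIntegral_algebraMap
  | add p q hp hq => rw [map_add]; exact hp.add hq
  | mul_X p l hp => rw [map_mul]; exact hp.mul (h l)

/-- By the Nullstellensatz a power of `∏ (x_l - z_l)`, over the finitely many zeros `z`, lies in
`I`, so each coordinate is integral over `K`. -/
theorem finite_quotient_of_finite_zeroLocus [IsAlgClosed K] {I : Ideal (MvPolynomial (Fin n) K)}
    (hI : (MvPolynomial.zeroLocus K I).Finite) : Module.Finite K (MvPolynomial (Fin n) K ⧸ I) := by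
  have hX : ∀ l, IsIntegral K (Ideal.Quotient.mk I (MvPolynomial.X l)) := by
    intro l
    have hmem : ∏ z ∈ hI.toFinset, (MvPolynomial.X l - MvPolynomial.C (z l)) ∈ I.radical := by
      rw [← MvPolynomial.vanishingIdeal_zeroLocus_eq_radical (K := K)]
      intro z hz
      rw [map_prod]
      exact Finset.prod_eq_zero (hI.mem_toFinset.mpr hz) (by simp)
    obtain ⟨k, hk⟩ := hmem
    refine ⟨(∏ z ∈ hI.toFinset, (X - C (z l))) ^ k,
      (Polynomial.monic_prod_of_monic _ _ fun z _ => Polynomial.monic_X_sub_C _).pow k, ?_⟩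
    rw [← Ideal.Quotient.eq_zero_iff_mem, map_pow, map_prod] at hk
    rw [Polynomial.eval₂_pow, Polynomial.eval₂_finsetProd, ← hk]
    congr 1
    refine Finset.prod_congr rfl fun z _ => ?_
    rw [Polynomial.eval₂_sub, Polynomial.eval₂_X, Polynomial.eval₂_C, map_sub]
    rfl
  have : Algebra.IsIntegral K (MvPolynomial (Fin n) K ⧸ I) :=
    isIntegral_of_surjective (Ideal.Quotient.mkₐ K I) (Ideal.Quotient.mkₐ_surjective K I) hX
  exact Algebra.IsIntegral.finite

/-- `finrank` is `0` also for infinite-dimensional spaces, which would erase `P` from `Σ_1`. So the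
local ring must be shown finite-dimensional, as a quotient of the coordinate ring of a finite
scheme, besides being nonzero. -/
theorem Endo.multiplicity_ne_zero [IsAlgClosed K] (hd : 2 ≤ d) {f : Endo K N d}
    (hf : IsTriangular f.poly) {P : ℙ K (Fin (N + 1) → K)} (hP : P ∈ f.fixedPoints) :
    f.multiplicity P ≠ 0 := by
  set y := coords P
  set j := chart P with hj
  set I := f.fixedIdeal j with hIdef
  set R := MvPolynomial (Fin (N + 1)) K
  set R' := Localization.AtPrime (pointIdeal y)
  have hgen : ∀ z : Fin (N + 1) → K, z ∈ MvPolynomial.zeroLocus K I ↔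
      z j = 1 ∧ f.toFun z = f.toFun z j • z := by
    intro z
    rw [hIdef, fixedIdeal, MvPolynomial.zeroLocus_span]
    simp only [Set.mem_ofPred_eq, Set.mem_union, Set.mem_singleton_iff, Set.mem_range]
    constructor
    · intro h
      refine ⟨by simpa [sub_eq_zero] using h _ (Or.inl rfl), funext fun i => ?_⟩
      have := h _ (Or.inr ⟨i, rfl⟩)
      rw [MvPolynomial.aeval_eq_eval, map_sub, map_mul, MvPolynomial.eval_X, sub_eq_zero] at this
      rw [Pi.smul_apply, smul_eq_mul, mul_comm]
      exact this
    · rintro ⟨h1, h2⟩ p (rfl | ⟨i, rfl⟩)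
      · simp [h1]
      · have := congrFun h2 i
        rw [Pi.smul_apply, smul_eq_mul, mul_comm] at this
        rw [MvPolynomial.aeval_eq_eval, map_sub, map_mul, MvPolynomial.eval_X, sub_eq_zero]
        exact this
  -- The points of the scheme in this chart are fixed vectors rescaled to have `j`-th coordinate
  -- `1`.
  have hZ : (MvPolynomial.zeroLocus K I).Finite := by
    refine (((Endo.isTriSystem hd hf).finite_fixedVectors hd).image
      fun v => (v j)⁻¹ • v).subset fun z hz => ?_
    obtain ⟨h1, h2⟩ := (hgen z).mp hz
    have hz0 : z ≠ 0 := by rintro rfl; simp at h1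
    obtain ⟨s, hs, hv⟩ := f.exists_smul_mem_fixedVectors hd hz0 h2
    refine ⟨_, hv, ?_⟩
    simp only [Pi.smul_apply, h1, smul_eq_mul, mul_one]
    rw [smul_smul, inv_mul_cancel₀ hs, one_smul]
  have hfinI : Module.Finite K (R ⧸ I) := finite_quotient_of_finite_zeroLocus hZ
  have hart : IsArtinianRing (R ⧸ I) := IsArtinianRing.of_finite K _
  have hle : I ≤ pointIdeal y := by
    have hy : y ∈ MvPolynomial.zeroLocus K I := (hgen y).mpr ⟨coords_chart P, f.toFun_coords hP⟩
    intro p hp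
    rw [pointIdeal, RingHom.mem_ker, ← MvPolynomial.aeval_eq_eval]
    exact hy p hp
  have hmap : I.map (algebraMap R R') ≠ ⊤ := by
    intro h
    have h1 : I.map (algebraMap R R') ≤ IsLocalRing.maximalIdeal R' := by
      rw [← Localization.AtPrime.map_eq_maximalIdeal]
      exact Ideal.map_mono hle
    exact (IsLocalRing.maximalIdeal.isMaximal R').ne_top (top_le_iff.mp (h ▸ h1))
  have : Nontrivial (R' ⧸ I.map (algebraMap R R')) := Ideal.Quotient.nontrivial_iff.mpr hmap
  let φ : (R ⧸ I) →ₐ[K] (R' ⧸ I.map (algebraMap R R')) :=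
    Ideal.quotientMapₐ (I.map (algebraMap R R')) (IsScalarTower.toAlgHom K R R')
      (Ideal.le_comap_map)
  have hφ : ∀ r, φ (Ideal.Quotient.mk I r) = Ideal.Quotient.mk _ (algebraMap R R' r) := fun _ => rfl
  have hsurj : Function.Surjective φ := by
    refine surjective_of_isUnit (B := R ⧸ I) (A := R' ⧸ I.map (algebraMap R R')) φ.toRingHom
      fun a => ?_
    obtain ⟨b, rfl⟩ := Ideal.Quotient.mk_surjective a
    obtain ⟨⟨r, s⟩, hrs⟩ := IsLocalization.surj (pointIdeal y).primeCompl b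
    refine ⟨Ideal.Quotient.mk I r, Ideal.Quotient.mk I s, ?_, ?_⟩
    · exact (IsLocalization.map_units R' s).map (Ideal.Quotient.mk (I.map (algebraMap R R')))
    · exact (map_mul (Ideal.Quotient.mk (I.map (algebraMap R R'))) _ _).symm.trans
        (congrArg (Ideal.Quotient.mk (I.map (algebraMap R R'))) hrs)
  have : Module.Finite K (R' ⧸ I.map (algebraMap R R')) :=
    Module.Finite.of_surjective φ.toLinearMap hsurj
  exact (Module.finrank_pos (R := K) (M := R' ⧸ I.map (algebraMap R R'))).ne'

end Multiplicity

/-! ### Recovering the multipliers from the multiplier map. -/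

theorem Endo.eval_multiplierSigma_eq_zero_iff [IsAlgClosed K] (hd : 2 ≤ d) {f : Endo K N d}
    (hf : IsTriangular f.poly) (γ : K[X]) :
    (f.multiplierSigma).eval γ = 0 ↔ ∃ P ∈ f.fixedPoints, γ = f.multiplierPoly P := by
  rw [multiplierSigma, finprod_mem_eq_finite_toFinset_prod _ (Endo.finite_fixedPoints hd hf),
    Polynomial.eval_prod, Finset.prod_eq_zero_iff]
  refine exists_congr fun P => ?_
  rw [Set.Finite.mem_toFinset]
  refine and_congr_right fun hP => ?_
  rw [Polynomial.eval_pow, pow_eq_zero_iff (Endo.multiplicity_ne_zero hd hf hP)]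
  simp [sub_eq_zero]

theorem Endo.multiplierSigma_eq {f g : Endo K N d} (h : g.multiplierMap = f.multiplierMap) :
    g.multiplierSigma = f.multiplierSigma := by
  ext a b
  exact congrFun h (a, b)

/-- The multipliers of a triangular endomorphism are determined by the multiplier map. -/
theorem Endo.multipliers_subset [IsAlgClosed K] (hd : 2 ≤ d) {f g : Endo K N d}
    (hf : IsTriangular f.poly) (hg : IsTriangular g.poly)
    (h : g.multiplierMap = f.multiplierMap) : multipliers g.poly ⊆ multipliers f.poly := by
  have hft := Endo.isTriSystem hd hf
  have hgt := Endo.isTriSystem hd hg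
  rintro _ ⟨v, hv, i, rfl⟩
  -- The origin and the radial direction are invisible in `Σ_1`, but give the multipliers `0` and
  -- `d` for every triangular map.
  by_cases hv0 : v = 0
  · subst hv0
    exact ⟨0, hft.zero_mem_fixedVectors hd, i, by
      rw [hft.eval_zero_pderiv hd, hgt.eval_zero_pderiv hd]⟩
  obtain ⟨P, hP, s, hs, rfl⟩ := g.exists_fixedPoint hv hv0
  by_cases hi : i = chart P
  · rw [hgt.eval_pderiv_first hd hv (i := i)]
    · exact hft.degree_mem_multipliers hd
    · rw [hi, Pi.smul_apply, coords_chart, smul_eq_mul, mul_one]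
      exact hs
    · intro l hl
      rw [Pi.smul_apply, coords_of_lt_chart P (hi ▸ hl), smul_zero]
  · obtain ⟨Q, hQ, hγ⟩ := (Endo.eval_multiplierSigma_eq_zero_iff hd hf (g.multiplierPoly P)).mp
      (Endo.multiplierSigma_eq h ▸
        (Endo.eval_multiplierSigma_eq_zero_iff hd hg _).mpr ⟨P, hP, rfl⟩)
    obtain ⟨t, ht, hw⟩ := f.exists_fixedVector hd hQ
    rw [Endo.multiplierPoly_eq_prod hg hd hP hs hv,
      Endo.multiplierPoly_eq_prod hf hd hQ ht hw] at hγ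
    -- The multiplier is a root of the characteristic polynomial of `g` at `P`, hence of the equal
    -- one of `f` at `Q`.
    have h0 := congrArg (Polynomial.eval
      (MvPolynomial.eval (s • coords P) (MvPolynomial.pderiv i (g.poly i)))) hγ
    rw [Polynomial.eval_prod, Polynomial.eval_prod,
      Finset.prod_eq_zero (Finset.mem_univ (⟨i, hi⟩ : {i // i ≠ chart P})) (by simp)] at h0
    obtain ⟨k, -, hk⟩ := Finset.prod_eq_zero_iff.mp h0.symm
    refine ⟨_, hw, k, ?_⟩
    simp only [Polynomial.eval_sub, Polynomial.eval_X, Polynomial.eval_C, sub_eq_zero] at hk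
    exact hk.symm

end TriangularEndo

/-! ### Openness of the generic condition. -/

section Openness

variable {K : Type*} [Field K]

/-- A point of `Spec R` either lifts to an integral extension or is separated from its image by an
element of the kernel. -/
theorem exists_lift_or_exists_mem_ker [IsAlgClosed K] {R A : Type*} [CommRing R] [Algebra K R]
    [CommRing A] [Algebra R A] [Algebra K A] [IsScalarTower K R A] [Algebra.IsIntegral R A]
    (ψ : R →ₐ[K] K) :
    (∃ χ : A →ₐ[K] K, ∀ r, χ (algebraMap R A r) = ψ r) ∨ ∃ r, algebraMap R A r = 0 ∧ ψ r ≠ 0 := by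
  -- If the kernel condition holds, lying over gives a maximal ideal above that of `ψ`; its residue
  -- field is integral over `K`, hence equal to `K`.
  by_cases hker : RingHom.ker (algebraMap R A) ≤ RingHom.ker ψ
  · left
    have hsurj : Function.Surjective ψ := fun c => ⟨algebraMap K R c, ψ.commutes c⟩
    have hmax : (RingHom.ker ψ).IsMaximal := RingHom.ker_isMaximal_of_surjective ψ hsurj
    obtain ⟨Q, hQ, hcomap⟩ :=
      Ideal.exists_ideal_over_maximal_of_isIntegral (S := A) (RingHom.ker ψ) hker
    have hψ : ∀ r, Ideal.Quotient.mk Q (algebraMap R A r) = algebraMap K (A ⧸ Q) (ψ r) := by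
      intro r
      have hr : r - algebraMap K R (ψ r) ∈ Q.comap (algebraMap R A) := by
        rw [hcomap, RingHom.mem_ker, map_sub, ψ.commutes]
        exact sub_self _
      rw [Ideal.mem_comap, map_sub, ← Ideal.Quotient.eq_zero_iff_mem, map_sub, sub_eq_zero,
        ← IsScalarTower.algebraMap_apply] at hr
      exact hr
    have : Algebra.IsIntegral K (A ⧸ Q) := by
      refine ⟨fun x => ?_⟩
      obtain ⟨a, rfl⟩ := Ideal.Quotient.mk_surjective x
      obtain ⟨p, hp, hpa⟩ := Algebra.IsIntegral.isIntegral (R := R) a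
      refine ⟨p.map ψ.toRingHom, hp.map _, ?_⟩
      rw [Polynomial.eval₂_map]
      have h : (algebraMap K (A ⧸ Q)).comp ψ.toRingHom =
          (Ideal.Quotient.mk Q).comp (algebraMap R A) := RingHom.ext fun r => (hψ r).symm
      rw [h, ← Polynomial.hom_eval₂, hpa, map_zero]
    have hbij := IsAlgClosed.algebraMap_bijective_of_isIntegral (k := K) (K := A ⧸ Q)
    let e : K ≃ₐ[K] (A ⧸ Q) := AlgEquiv.ofBijective (Algebra.ofId K (A ⧸ Q)) hbij
    refine ⟨(e.symm : (A ⧸ Q) →ₐ[K] K).comp (Ideal.Quotient.mkₐ K Q), fun r => ?_⟩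
    refine (AlgEquiv.symm_apply_eq e).mpr ?_
    exact hψ r
  · right
    obtain ⟨r, hr, hr'⟩ := SetLike.not_le_iff_exists.mp hker
    exact ⟨r, hr, hr'⟩

theorem isIntegral_of_pow_eq {R A ι : Type*} [CommRing R] [CommRing A] [Algebra R A] {d : ℕ}
    (hd : 2 ≤ d) {x o₀ : A} (s : Finset ι) {o : ι → A} {e : ι → ℕ} (ho₀ : IsIntegral R o₀)
    (ho : ∀ m ∈ s, IsIntegral R (o m)) (he : ∀ m ∈ s, e m < d)
    (hx : x ^ d = o₀ * x + ∑ m ∈ s, o m * x ^ e m) : IsIntegral R x := by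
  let O := integralClosure R A
  have hO : ∀ m : s, o m ∈ O := fun m => ho m m.2
  let q : O[X] := C ⟨o₀, ho₀⟩ * X + ∑ m : s, C ⟨o m, hO m⟩ * X ^ e m
  have hint : IsIntegral O x := by
    nontriviality A
    have : Nontrivial O := inferInstance
    refine ⟨X ^ d - q, Polynomial.monic_X_pow_sub ?_, ?_⟩
    · refine (Polynomial.degree_add_le _ _).trans_lt (max_lt ?_ ?_)
      · refine (Polynomial.degree_C_mul_X_le _).trans_lt ?_
        exact_mod_cast (by omega : 1 < d)
      · refine (Polynomial.degree_sum_le _ _).trans_lt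
          ((Finset.sup_lt_iff (show (⊥ : WithBot ℕ) < (d : WithBot ℕ) from WithBot.bot_lt_coe d)).mpr fun m _ => ?_)
        refine (Polynomial.degree_C_mul_X_pow_le _ _).trans_lt ?_
        exact_mod_cast he m m.2
    · simp only [q, Polynomial.eval₂_sub, Polynomial.eval₂_add, Polynomial.eval₂_mul,
        Polynomial.eval₂_C, Polynomial.eval₂_X, Polynomial.eval₂_pow, Polynomial.eval₂_finsetSum]
      rw [hx, sub_eq_zero, ← Finset.sum_coe_sort s fun m => o m * x ^ e m]
      rfl
  exact isIntegral_trans (R := R) (A := O) x hint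

/-- A polynomial in the `x κ` that vanishes if and only if one of them is `1` or the sum of the
`1 / (x κ - 1)` vanishes. -/
def reciprocalSum {A : Type*} [CommRing A] {k : ℕ} (x : Fin k → A) : A :=
  (∏ κ, (x κ - 1)) * ∑ κ, ∏ j ∈ Finset.univ.erase κ, (x j - 1)

theorem map_reciprocalSum {A B : Type*} [CommRing A] [CommRing B] {k : ℕ} (φ : A →+* B)
    (x : Fin k → A) : φ (reciprocalSum x) = reciprocalSum fun κ => φ (x κ) := by
  simp [reciprocalSum, map_prod, map_sum]

theorem reciprocalSum_eq_zero_iff {k : ℕ} (x : Fin k → K) :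
    reciprocalSum x = 0 ↔ (∃ κ, x κ = 1) ∨ ∑ κ, (x κ - 1)⁻¹ = 0 := by
  by_cases h : ∃ κ, x κ = 1
  · obtain ⟨κ, hκ⟩ := h
    have h0 : ∏ j, (x j - 1) = 0 := Finset.prod_eq_zero (Finset.mem_univ κ) (sub_eq_zero.mpr hκ)
    rw [reciprocalSum, h0, zero_mul]
    exact iff_of_true rfl (Or.inl ⟨κ, hκ⟩)
  · have hne : ∀ κ, x κ - 1 ≠ 0 := fun κ hκ => h ⟨κ, sub_eq_zero.mp hκ⟩
    have hprod : ∏ κ, (x κ - 1) ≠ 0 := Finset.prod_ne_zero_iff.mpr fun κ _ => hne κ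
    have hsum : ∑ κ, ∏ j ∈ Finset.univ.erase κ, (x j - 1) =
        (∏ κ, (x κ - 1)) * ∑ κ, (x κ - 1)⁻¹ := by
      rw [Finset.mul_sum]
      refine Finset.sum_congr rfl fun κ _ => ?_
      rw [← Finset.mul_prod_erase _ _ (Finset.mem_univ κ), mul_comm, inv_mul_cancel_left₀ (hne κ)]
    rw [reciprocalSum, hsum, mul_eq_zero, mul_eq_zero]
    simp [hprod, h]

/-! ### The universal triangular system. -/

variable {N d : ℕ}

/-- The coefficient of `x_i ^ d` in the `i`-th polynomial. -/
noncomputable def Endo.diagCoeff (f : Endo K N d) (i : Fin (N + 1)) : K :=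
  (f.poly i).coeff (Finsupp.single i d)

variable (K N) in
/-- Polynomials in the coefficients of an endomorphism and the inverses of the coefficients of the
`x_i ^ d`. -/
abbrev CoeffRing := MvPolynomial ((Fin (N + 1) × (Fin (N + 1) →₀ ℕ)) ⊕ Fin (N + 1)) K

/-- The evaluation at an endomorphism. -/
noncomputable def Endo.evalCoeff (f : Endo K N d) : CoeffRing K N →ₐ[K] K :=
  MvPolynomial.aeval (Sum.elim (fun p => (f.poly p.1).coeff p.2) fun i => (f.diagCoeff i)⁻¹)

/-- A condition using the inverses of the diagonal coefficients becomes a basic open condition in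
the coefficients alone, where those coefficients are nonzero. -/
theorem exists_clear_denominators (r : CoeffRing K N) :
    ∃ (Φ : MvPolynomial (Fin (N + 1) × (Fin (N + 1) →₀ ℕ)) K) (e : ℕ), ∀ f : Endo K N d,
      (∀ i, f.diagCoeff i ≠ 0) → MvPolynomial.eval (fun p => (f.poly p.1).coeff p.2) Φ =
        (∏ i, f.diagCoeff i) ^ e * f.evalCoeff r := by
  let D : MvPolynomial (Fin (N + 1) × (Fin (N + 1) →₀ ℕ)) K :=
    ∏ i, MvPolynomial.X (i, Finsupp.single i d)
  have hD : ∀ f : Endo K N d, MvPolynomial.eval (fun p => (f.poly p.1).coeff p.2) D =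
      ∏ i, f.diagCoeff i := fun f => by simp [D, map_prod, Endo.diagCoeff]
  induction r using MvPolynomial.induction_on with
  | C a => exact ⟨MvPolynomial.C a, 0, fun f _ => by simp [Endo.evalCoeff]⟩
  | add p q hp hq =>
    obtain ⟨Φ, e, h⟩ := hp
    obtain ⟨Ψ, e', h'⟩ := hq
    refine ⟨D ^ e' * Φ + D ^ e * Ψ, e + e', fun f hf => ?_⟩
    rw [map_add, map_mul, map_mul, map_pow, map_pow, hD, h f hf, h' f hf, map_add, pow_add]
    ring
  | mul_X p x hp =>
    obtain ⟨Φ, e, h⟩ := hp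
    rcases x with x | i
    · refine ⟨Φ * MvPolynomial.X x, e, fun f hf => ?_⟩
      rw [map_mul, h f hf, map_mul, MvPolynomial.eval_X, mul_assoc]
      simp [Endo.evalCoeff]
    · refine ⟨Φ * ∏ l ∈ Finset.univ.erase i, MvPolynomial.X (l, Finsupp.single l d), e + 1,
        fun f hf => ?_⟩
      have h1 : MvPolynomial.eval (fun p => (f.poly p.1).coeff p.2)
          (∏ l ∈ Finset.univ.erase i, MvPolynomial.X (l, Finsupp.single l d)) =
          ∏ l ∈ Finset.univ.erase i, f.diagCoeff l := by simp [map_prod, Endo.diagCoeff]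
      have h2 : f.evalCoeff (MvPolynomial.X (Sum.inr i)) = (f.diagCoeff i)⁻¹ := by
        simp [Endo.evalCoeff]
      rw [map_mul, h f hf, h1, map_mul, h2, pow_succ,
        ← Finset.mul_prod_erase _ _ (Finset.mem_univ i)]
      have := hf i
      field_simp

/-- The exponents of degree `d` that involve only the variables up to `x_i`, except for that of
`x_i ^ d`. -/
noncomputable def lowerExponents (N d : ℕ) (i : Fin (N + 1)) : Finset (Fin (N + 1) →₀ ℕ) :=
  ((Finset.univ : Finset (Fin (N + 1))).finsuppAntidiag d).filter
    fun m => m ≠ Finsupp.single i d ∧ ∀ l, i < l → m l = 0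

theorem mem_lowerExponents {i : Fin (N + 1)} {m : Fin (N + 1) →₀ ℕ} :
    m ∈ lowerExponents N d i ↔
      m.degree = d ∧ m ≠ Finsupp.single i d ∧ ∀ l, i < l → m l = 0 := by
  simp [lowerExponents, Finset.mem_finsuppAntidiag, Finsupp.degree_eq_sum]

theorem lt_of_mem_lowerExponents {i : Fin (N + 1)} {m : Fin (N + 1) →₀ ℕ}
    (hm : m ∈ lowerExponents N d i) : m i < d := by
  obtain ⟨h1, h2, -⟩ := mem_lowerExponents.mp hm
  refine lt_of_le_of_ne (h1 ▸ Finsupp.le_degree i m) fun h => h2 ?_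
  rw [← h] at h1 ⊢
  exact eq_single_of_degree_eq h1

variable (K) in
/-- The universal triangular polynomial without its term in `x_i ^ d`. -/
noncomputable def lowerPoly (N d : ℕ) (i : Fin (N + 1)) :
    MvPolynomial (Fin (N + 1)) (CoeffRing K N) :=
  ∑ m ∈ lowerExponents N d i, MvPolynomial.monomial m (MvPolynomial.X (Sum.inl (i, m)))

variable (K) in
/-- The universal triangular polynomial. -/
noncomputable def universalPoly (N d : ℕ) (i : Fin (N + 1)) :
    MvPolynomial (Fin (N + 1)) (CoeffRing K N) :=
  lowerPoly K N d i + MvPolynomial.monomial (Finsupp.single i d)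
    (MvPolynomial.X (Sum.inl (i, Finsupp.single i d)))

theorem map_lowerPoly {f : Endo K N d} (hf : IsTriangular f.poly) (i : Fin (N + 1)) :
    MvPolynomial.map f.evalCoeff.toRingHom (lowerPoly K N d i) =
      f.poly i - MvPolynomial.monomial (Finsupp.single i d) (f.diagCoeff i) := by
  classical
  have hX : ∀ m, f.evalCoeff.toRingHom (MvPolynomial.X (Sum.inl (i, m))) = (f.poly i).coeff m :=
    fun m => by simp [Endo.evalCoeff]
  rw [lowerPoly, map_sum]
  ext m
  rw [MvPolynomial.coeff_sum]
  simp only [MvPolynomial.map_monomial, hX, MvPolynomial.coeff_monomial, MvPolynomial.coeff_sub,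
    Finset.sum_ite_eq']
  by_cases hm : m ∈ lowerExponents N d i
  · rw [if_pos hm, if_neg (Ne.symm (mem_lowerExponents.mp hm).2.1), sub_zero]
  · rw [if_neg hm]
    by_cases hs : Finsupp.single i d = m
    · rw [if_pos hs, ← hs, Endo.diagCoeff, sub_self]
    · rw [if_neg hs, sub_zero, eq_comm]
      by_contra hne
      have hsupp := MvPolynomial.mem_support_iff.mpr hne
      refine hm (mem_lowerExponents.mpr ⟨degree_of_mem_support (f.homogeneous i) hsupp,
        Ne.symm hs, fun l hl => ?_⟩)
      by_contra hml
      exact absurd (hf i l ((MvPolynomial.mem_vars_iff_mem_support l).mpr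
        ⟨m, hsupp, Finsupp.mem_support_iff.mpr hml⟩)) (not_le.mpr hl)

theorem map_universalPoly {f : Endo K N d} (hf : IsTriangular f.poly) (i : Fin (N + 1)) :
    MvPolynomial.map f.evalCoeff.toRingHom (universalPoly K N d i) = f.poly i := by
  rw [universalPoly, map_add, map_lowerPoly hf, MvPolynomial.map_monomial]
  have : f.evalCoeff.toRingHom (MvPolynomial.X (Sum.inl (i, Finsupp.single i d))) =
    f.diagCoeff i := by simp [Endo.evalCoeff, Endo.diagCoeff]
  rw [this, sub_add_cancel]

section Universal

variable (K N d) (k : ℕ)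

/-- Polynomials in the coordinates of `k` vectors over `CoeffRing`. -/
abbrev VectorRing := MvPolynomial (Fin k × Fin (N + 1)) (CoeffRing K N)

/-- The fixed vector equation for the `i`-th coordinate of the `κ`-th vector, divided by the
coefficient of `x_i ^ d`. -/
noncomputable def fixedRelation (κ : Fin k) (i : Fin (N + 1)) : VectorRing K N k :=
  MvPolynomial.X (κ, i) ^ d - MvPolynomial.C (MvPolynomial.X (Sum.inr i)) *
    (MvPolynomial.X (κ, i) - MvPolynomial.aeval (fun l => MvPolynomial.X (κ, l)) (lowerPoly K N d i))

/-- The `ι κ`-th multiplier at the `κ`-th vector. -/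
noncomputable def universalMultiplier (ι : Fin k → Fin (N + 1)) (κ : Fin k) : VectorRing K N k :=
  MvPolynomial.aeval (fun l => MvPolynomial.X (κ, l))
    (MvPolynomial.pderiv (ι κ) (universalPoly K N d (ι κ)))

/-- The locus where the vectors are fixed and the reciprocal sum of the multipliers vanishes. -/
noncomputable def badIdeal (ι : Fin k → Fin (N + 1)) : Ideal (VectorRing K N k) :=
  Ideal.span (insert (reciprocalSum (universalMultiplier K N d k ι))
    (Set.range fun x : Fin k × Fin (N + 1) => fixedRelation K N d k x.1 x.2))

end Universal

variable {k : ℕ}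

theorem map_aeval_X {f : Endo K N d} {Θ : VectorRing K N k →+* K}
    (hΘ : ∀ r, Θ (MvPolynomial.C r) = f.evalCoeff r) (κ : Fin k)
    (p : MvPolynomial (Fin (N + 1)) (CoeffRing K N)) :
    Θ (MvPolynomial.aeval (fun l => MvPolynomial.X (κ, l)) p) =
      MvPolynomial.eval (fun l => Θ (MvPolynomial.X (κ, l)))
        (MvPolynomial.map f.evalCoeff.toRingHom p) := by
  induction p using MvPolynomial.induction_on with
  | C a =>
    rw [MvPolynomial.aeval_C, MvPolynomial.map_C, MvPolynomial.eval_C]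
    exact hΘ a
  | add p q hp hq => simp only [map_add, hp, hq]
  | mul_X p l hp => simp only [map_mul, hp, MvPolynomial.aeval_X, MvPolynomial.map_X,
      MvPolynomial.eval_X]

theorem map_fixedRelation {f : Endo K N d} (hf : IsTriangular f.poly)
    {Θ : VectorRing K N k →+* K} (hΘ : ∀ r, Θ (MvPolynomial.C r) = f.evalCoeff r) (κ : Fin k)
    {i : Fin (N + 1)} (hi : f.diagCoeff i ≠ 0) :
    Θ (fixedRelation K N d k κ i) = (f.diagCoeff i)⁻¹ *
      (MvPolynomial.eval (fun l => Θ (MvPolynomial.X (κ, l))) (f.poly i) -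
        Θ (MvPolynomial.X (κ, i))) := by
  have h : f.evalCoeff (MvPolynomial.X (Sum.inr i)) = (f.diagCoeff i)⁻¹ := by
    simp [Endo.evalCoeff]
  rw [fixedRelation, map_sub, map_mul, map_sub, map_pow, hΘ, h, map_aeval_X hΘ, map_lowerPoly hf,
    map_sub, MvPolynomial.eval_monomial, Finsupp.prod_single_index (by exact pow_zero _)]
  field_simp
  ring

theorem map_universalMultiplier {f : Endo K N d} (hf : IsTriangular f.poly)
    {Θ : VectorRing K N k →+* K} (hΘ : ∀ r, Θ (MvPolynomial.C r) = f.evalCoeff r)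
    (ι : Fin k → Fin (N + 1)) (κ : Fin k) :
    Θ (universalMultiplier K N d k ι κ) =
      MvPolynomial.eval (fun l => Θ (MvPolynomial.X (κ, l)))
        (MvPolynomial.pderiv (ι κ) (f.poly (ι κ))) := by
  rw [universalMultiplier, map_aeval_X hΘ, ← MvPolynomial.pderiv_map, map_universalPoly hf]

theorem isIntegral_of_triangular_relations {R A : Type*} [CommRing R] [CommRing A] [Algebra R A]
    (hd : 2 ≤ d) {Y : Fin (N + 1) → A} {b : Fin (N + 1) → R}
    {c : Fin (N + 1) → (Fin (N + 1) →₀ ℕ) → R}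
    (h : ∀ i, Y i ^ d = algebraMap R A (b i) *
      (Y i - ∑ m ∈ lowerExponents N d i, algebraMap R A (c i m) * ∏ l, Y l ^ m l))
    (i : Fin (N + 1)) : IsIntegral R (Y i) := by
  induction i using WellFoundedLT.induction with
  | ind i ih =>
    refine isIntegral_of_pow_eq hd (lowerExponents N d i)
      (o₀ := algebraMap R A (b i)) (e := fun m => m i)
      (o := fun m => -(algebraMap R A (b i * c i m) * ∏ l ∈ Finset.univ.erase i, Y l ^ m l))
      isIntegral_algebraMap (fun m hm => ?_) (fun m hm => lt_of_mem_lowerExponents hm) ?_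
    · refine (isIntegral_algebraMap.mul (IsIntegral.prod _ fun l hl => ?_)).neg
      rcases lt_or_gt_of_ne (Finset.ne_of_mem_erase hl) with h | h
      · exact (ih l h).pow _
      · rw [(mem_lowerExponents.mp hm).2.2 l h, pow_zero]
        exact isIntegral_one
    · rw [h i, mul_sub, Finset.mul_sum, sub_eq_add_neg, ← Finset.sum_neg_distrib]
      congr 1
      refine Finset.sum_congr rfl fun m _ => ?_
      rw [← Finset.mul_prod_erase _ _ (Finset.mem_univ i), map_mul]
      ring

theorem mkₐ_eq_zero {R A : Type*} [CommRing R] [CommRing A] [Algebra R A] {I : Ideal A} {a : A}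
    (h : a ∈ I) : Ideal.Quotient.mkₐ R I a = 0 :=
  Ideal.Quotient.eq_zero_iff_mem.mpr h

theorem fixedRelation_mem_badIdeal (ι : Fin k → Fin (N + 1)) (κ : Fin k) (i : Fin (N + 1)) :
    fixedRelation K N d k κ i ∈ badIdeal K N d k ι :=
  Ideal.subset_span (Set.mem_insert_of_mem _
    (Set.mem_range_self (f := fun x : Fin k × Fin (N + 1) => fixedRelation K N d k x.1 x.2) (κ, i)))

/-- Dividing by the coefficient of `x_i ^ d` makes the fixed vector equations monic in `x_i`, which
is why `CoeffRing` has variables for the inverses. Those stay independent of the coefficients; only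
`Endo.evalCoeff` relates them. -/
theorem isIntegral_quotient_badIdeal (hd : 2 ≤ d) (ι : Fin k → Fin (N + 1)) :
    Algebra.IsIntegral (CoeffRing K N) (VectorRing K N k ⧸ badIdeal K N d k ι) := by
  set φ := Ideal.Quotient.mkₐ (CoeffRing K N) (badIdeal K N d k ι) with hφ
  refine isIntegral_of_surjective (R := CoeffRing K N) (σ := Fin k × Fin (N + 1))
    (A := VectorRing K N k ⧸ badIdeal K N d k ι) φ (Ideal.Quotient.mkₐ_surjective _ _)
    fun ⟨κ, i⟩ => ?_
  refine isIntegral_of_triangular_relations hd (Y := fun i => φ (MvPolynomial.X (κ, i)))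
    (b := fun i => MvPolynomial.X (Sum.inr i)) (c := fun i m => MvPolynomial.X (Sum.inl (i, m)))
    (fun i => ?_) i
  have hrel : φ (fixedRelation K N d k κ i) = 0 := mkₐ_eq_zero (fixedRelation_mem_badIdeal ι κ i)
  have hC : ∀ r, φ (MvPolynomial.C r) = algebraMap (CoeffRing K N) _ r := fun r => φ.commutes r
  rw [fixedRelation, map_sub, map_mul, map_sub, map_pow, sub_eq_zero, hC] at hrel
  rw [hrel, lowerPoly, map_sum, map_sum]
  congr 2
  refine Finset.sum_congr rfl fun m _ => ?_
  rw [MvPolynomial.aeval_monomial, Finsupp.prod_pow, map_mul, map_prod, MvPolynomial.algebraMap_eq,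
    hC]
  simp only [map_pow]

/-- The image of the bad locus is closed by integrality. A lift of `f₀` would be a tuple of fixed
vectors excluded by `h₀`; otherwise some `r` in the bad ideal is nonzero at `f₀`, and it vanishes at
every triangular `f` with such a tuple. -/
theorem exists_separating_element [IsAlgClosed K] (hd : 2 ≤ d) (ι : Fin k → Fin (N + 1))
    {f₀ : Endo K N d} (hf₀ : IsTriangular f₀.poly)
    (h₀ : ∀ v : Fin k → Fin (N + 1) → K, (∀ κ, v κ ∈ fixedVectors f₀.poly) → reciprocalSum
      (fun κ => MvPolynomial.eval (v κ) (MvPolynomial.pderiv (ι κ) (f₀.poly (ι κ)))) ≠ 0) :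
    ∃ r : CoeffRing K N, f₀.evalCoeff r ≠ 0 ∧ ∀ f : Endo K N d, IsTriangular f.poly →
      f.evalCoeff r ≠ 0 → ∀ v : Fin k → Fin (N + 1) → K, (∀ κ, v κ ∈ fixedVectors f.poly) →
      reciprocalSum
        (fun κ => MvPolynomial.eval (v κ) (MvPolynomial.pderiv (ι κ) (f.poly (ι κ)))) ≠ 0 := by
  have := isIntegral_quotient_badIdeal (K := K) hd ι
  rcases exists_lift_or_exists_mem_ker (A := VectorRing K N k ⧸ badIdeal K N d k ι)
    f₀.evalCoeff with ⟨χ, hχ⟩ | ⟨r, hr, hr₀⟩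
  · exfalso
    let Θ : VectorRing K N k →+* K := χ.toRingHom.comp (Ideal.Quotient.mk _)
    have hΘ : ∀ r, Θ (MvPolynomial.C r) = f₀.evalCoeff r := hχ
    have hzero : ∀ p ∈ badIdeal K N d k ι, Θ p = 0 := fun p hp => by
      have h : Ideal.Quotient.mk (badIdeal K N d k ι) p = 0 := Ideal.Quotient.eq_zero_iff_mem.mpr hp
      change χ (Ideal.Quotient.mk _ p) = 0
      rw [h, map_zero]
    refine h₀ (fun κ l => Θ (MvPolynomial.X (κ, l))) (fun κ i => ?_) ?_
    · have hi := (Endo.isTriSystem hd hf₀).coeff_ne_zero i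
      have h := hzero _ (fixedRelation_mem_badIdeal ι κ i)
      rw [map_fixedRelation hf₀ hΘ κ hi, mul_eq_zero, sub_eq_zero] at h
      exact h.resolve_left (inv_ne_zero hi)
    · have h := hzero _ (Ideal.subset_span (Set.mem_insert _ _))
      rw [map_reciprocalSum] at h
      simpa only [map_universalMultiplier hf₀ hΘ] using h
  · refine ⟨r, hr₀, fun f hf hfr v hv hbad => hfr ?_⟩
    let Θ : VectorRing K N k →+* K :=
      MvPolynomial.eval₂Hom f.evalCoeff.toRingHom fun x => v x.1 x.2
    have hΘ : ∀ r, Θ (MvPolynomial.C r) = f.evalCoeff r := fun r => MvPolynomial.eval₂_C _ _ _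
    have hΘX : ∀ x, Θ (MvPolynomial.X x) = v x.1 x.2 := fun x => MvPolynomial.eval₂_X _ _ _
    have hle : badIdeal K N d k ι ≤ RingHom.ker Θ := by
      refine Ideal.span_le.mpr (Set.insert_subset ?_ ?_)
      · rw [SetLike.mem_coe, RingHom.mem_ker, map_reciprocalSum]
        simpa only [map_universalMultiplier hf hΘ, hΘX] using hbad
      · rintro _ ⟨⟨κ, i⟩, rfl⟩
        rw [SetLike.mem_coe, RingHom.mem_ker, map_fixedRelation hf hΘ κ
          ((Endo.isTriSystem hd hf).coeff_ne_zero i)]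
        simp only [hΘX]
        rw [hv κ i, sub_self, mul_zero]
    rw [← hΘ]
    exact hle (Ideal.Quotient.eq_zero_iff_mem.mp hr)

theorem exists_isOpen_noVanishingSum [IsAlgClosed K] (hd : 2 ≤ d)
    {f₀ : Endo K N d} (hf₀ : IsTriangular f₀.poly)
    (h₀ : NoVanishingSum d (multipliers f₀.poly)) :
    ∃ U : Set (Endo K N d), IsOpen U ∧ f₀ ∈ U ∧
      ∀ f ∈ U, IsTriangular f.poly → NoVanishingSum d (multipliers f.poly) := by
  -- The sums have `k + 1` terms, from `1` to `d - 1`. With the choice `ι` of diagonal entries there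
  -- are finitely many conditions, so the open sets can be intersected.
  have key : ∀ (k : Fin (d - 1)) (ι : Fin (k + 1) → Fin (N + 1)), ∃ U : Set (Endo K N d),
      IsOpen U ∧ f₀ ∈ U ∧ ∀ f ∈ U, IsTriangular f.poly →
        ∀ v : Fin (k + 1) → Fin (N + 1) → K, (∀ κ, v κ ∈ fixedVectors f.poly) → reciprocalSum
          (fun κ => MvPolynomial.eval (v κ) (MvPolynomial.pderiv (ι κ) (f.poly (ι κ)))) ≠ 0 := by
    intro k ι
    obtain ⟨r, hr₀, hr⟩ := exists_separating_element hd ι hf₀ (fun v hv hzero => by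
      have hmem : ∀ κ, MvPolynomial.eval (v κ) (MvPolynomial.pderiv (ι κ) (f₀.poly (ι κ))) ∈
          multipliers f₀.poly := fun κ => ⟨v κ, hv κ, ι κ, rfl⟩
      rcases (reciprocalSum_eq_zero_iff _).mp hzero with ⟨κ, hκ⟩ | hsum
      · exact h₀.one_notMem hd (hκ ▸ hmem κ)
      · refine h₀ (Finset.univ.val.map fun κ => MvPolynomial.eval (v κ)
          (MvPolynomial.pderiv (ι κ) (f₀.poly (ι κ)))) ?_ ?_ ?_ ?_
        · simp
        · have := k.isLt
          simp
          omega
        · simp only [Multiset.mem_map]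
          rintro _ ⟨κ, -, rfl⟩
          exact hmem κ
        · rw [Multiset.map_map]
          exact hsum)
    obtain ⟨Φ, e, hΦ⟩ := exists_clear_denominators (d := d) r
    refine ⟨{f | MvPolynomial.eval (fun p => (f.poly p.1).coeff p.2) Φ ≠ 0},
      TopologicalSpace.isOpen_generateFrom_of_mem ⟨Φ, rfl⟩, ?_, fun f hfU hf => hr f hf ?_⟩
    · have ha := (Endo.isTriSystem hd hf₀).coeff_ne_zero
      rw [Set.mem_ofPred_eq, hΦ f₀ ha]
      exact mul_ne_zero (pow_ne_zero _ (Finset.prod_ne_zero_iff.mpr fun i _ => ha i)) hr₀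
    · rw [Set.mem_ofPred_eq, hΦ f (Endo.isTriSystem hd hf).coeff_ne_zero] at hfU
      exact right_ne_zero_of_mul hfU
  choose U hU hU₀ hUf using key
  refine ⟨⋂ k, ⋂ ι, U k ι, isOpen_iInter_of_finite fun k => isOpen_iInter_of_finite fun ι => hU k ι,
    Set.mem_iInter₂.mpr hU₀, fun f hf hft M hM hcard hMS hsum => ?_⟩
  obtain ⟨k, hk⟩ : ∃ k, M.card = k + 1 :=
    Nat.exists_eq_succ_of_ne_zero fun h => hM (Multiset.card_eq_zero.mp h)
  obtain ⟨x, hx⟩ := exists_fin_map_eq M hk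
  have hxM : ∀ κ, x κ ∈ multipliers f.poly := fun κ => hMS _ (by
    rw [← hx]; exact Multiset.mem_map_of_mem _ (Finset.mem_univ κ))
  choose v hv ι hι using hxM
  refine hUf ⟨k, by omega⟩ ι f (Set.mem_iInter₂.mp hf _ _) hft v hv ?_
  rw [reciprocalSum_eq_zero_iff]
  right
  rw [← hx, Multiset.map_map] at hsum
  simp only [hι]
  exact hsum

end Openness

/-! ### Homogenization, triangularity and the power map. -/

section Homogenize

variable {K : Type*} [Field K] {N d : ℕ}

theorem homogenize_eq_sum (p : MvPolynomial (Fin N) K) {s : Finset (Fin N →₀ ℕ)}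
    (hs : p.support ⊆ s) : homogenize d p =
      ∑ m ∈ s, MvPolynomial.monomial (m.cons (d - m.degree)) (p.coeff m) := by
  refine Finset.sum_subset hs fun m _ hm => ?_
  rw [MvPolynomial.notMem_support_iff.mp hm, map_zero]

theorem homogenize_add_smul (a b : K) (p q : MvPolynomial (Fin N) K) :
    homogenize d (a • p + b • q) = a • homogenize d p + b • homogenize d q := by
  classical
  have hp : (p.support ⊆ p.support ∪ q.support) := Finset.subset_union_left
  have hq : (q.support ⊆ p.support ∪ q.support) := Finset.subset_union_right
  rw [homogenize_eq_sum p hp, homogenize_eq_sum q hq, homogenize_eq_sum (a • p + b • q)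
    (MvPolynomial.support_add.trans (Finset.union_subset
      (MvPolynomial.support_smul.trans hp) (MvPolynomial.support_smul.trans hq))),
    Finset.smul_sum, Finset.smul_sum, ← Finset.sum_add_distrib]
  refine Finset.sum_congr rfl fun m _ => ?_
  rw [MvPolynomial.coeff_add, MvPolynomial.coeff_smul, MvPolynomial.coeff_smul, map_add,
    MvPolynomial.smul_monomial, MvPolynomial.smul_monomial]

theorem homogenize_X_pow (i : Fin N) :
    homogenize d (MvPolynomial.X i ^ d : MvPolynomial (Fin N) K) = MvPolynomial.X i.succ ^ d := by
  rw [MvPolynomial.X_pow_eq_monomial, MvPolynomial.X_pow_eq_monomial,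
    homogenize_eq_sum _ MvPolynomial.support_monomial_subset, Finset.sum_singleton,
    MvPolynomial.coeff_monomial, if_pos rfl, Finsupp.degree_single, Nat.sub_self]
  refine congrArg (fun m => MvPolynomial.monomial m (1 : K)) (Finsupp.ext fun j => ?_)
  refine Fin.cases ?_ (fun j => ?_) j
  · rw [Finsupp.cons_zero, Finsupp.single_eq_of_ne (Fin.succ_ne_zero i).symm]
  · rw [Finsupp.cons_succ]
    by_cases h : j = i
    · rw [h, Finsupp.single_eq_same, Finsupp.single_eq_same]
    · rw [Finsupp.single_eq_of_ne h, Finsupp.single_eq_of_ne fun h' => h (Fin.succ_injective _ h')]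

theorem homogenizeMap_add_smul (a b : K) (h : a + b = 1) (F G : Fin N → MvPolynomial (Fin N) K)
    (i : Fin (N + 1)) : homogenizeMap d (fun i => a • F i + b • G i) i =
      a • homogenizeMap d F i + b • homogenizeMap d G i := by
  refine Fin.cases ?_ (fun i => ?_) i
  · simp only [homogenizeMap, Fin.cons_zero]
    rw [← add_smul, h, one_smul]
  · simp only [homogenizeMap, Fin.cons_succ]
    rw [homogenize_add_smul]

theorem homogenizeMap_X_pow (i : Fin (N + 1)) :
    homogenizeMap d (fun i : Fin N => (MvPolynomial.X i ^ d : MvPolynomial (Fin N) K)) i =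
      MvPolynomial.X i ^ d := by
  refine Fin.cases ?_ (fun i => ?_) i
  · rfl
  · simp only [homogenizeMap, Fin.cons_succ]
    exact homogenize_X_pow i

theorem isTriangular_X_pow {n : ℕ} :
    IsTriangular fun i : Fin n => (MvPolynomial.X i ^ d : MvPolynomial (Fin n) K) := by
  intro i j hj
  have := MvPolynomial.vars_pow _ _ hj
  rw [MvPolynomial.vars_X, Finset.mem_singleton] at this
  exact this.le

theorem isTriangular_add_smul {n : ℕ} (a b : K) {F G : Fin n → MvPolynomial (Fin n) K}
    (hF : IsTriangular F) (hG : IsTriangular G) : IsTriangular fun i => a • F i + b • G i := by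
  classical
  intro i j hj
  obtain ⟨m, hm, hj⟩ := (MvPolynomial.mem_vars_iff_mem_support j).mp hj
  rcases Finset.mem_union.mp (MvPolynomial.support_add hm) with h | h
  · exact hF i j ((MvPolynomial.mem_vars_iff_mem_support j).mpr
      ⟨m, MvPolynomial.support_smul h, hj⟩)
  · exact hG i j ((MvPolynomial.mem_vars_iff_mem_support j).mpr
      ⟨m, MvPolynomial.support_smul h, hj⟩)

theorem isTriangular_homogenizeMap {F : Fin N → MvPolynomial (Fin N) K} (hF : IsTriangular F) :
    IsTriangular (homogenizeMap d F) := by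
  intro i
  refine Fin.cases (fun j hj => ?_) (fun i j hj => ?_) i
  · exact isTriangular_X_pow (d := d) (K := K) 0 j hj
  · simp only [homogenizeMap, Fin.cons_succ] at hj
    obtain ⟨s, hs, hj⟩ := (MvPolynomial.mem_vars_iff_mem_support j).mp hj
    obtain ⟨m, hm, hms⟩ := Finset.mem_biUnion.mp (MvPolynomial.support_sum hs)
    have hsm := Finset.mem_singleton.mp (MvPolynomial.support_monomial_subset hms)
    subst hsm
    revert hj
    refine Fin.cases (fun _ => Fin.zero_le _) (fun j hj => ?_) j
    rw [Finsupp.mem_support_iff, Finsupp.cons_succ] at hj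
    exact Fin.succ_le_succ_iff.mpr (hF i j ((MvPolynomial.mem_vars_iff_mem_support j).mpr
      ⟨m, hm, Finsupp.mem_support_iff.mpr hj⟩))

theorem isTriangular_of_mem_triangularEndos {f : Endo K N d} (hf : f ∈ triangularEndos K N d) :
    IsTriangular f.poly := by
  obtain ⟨F, hF, -, h⟩ := hf
  rw [h]
  exact isTriangular_homogenizeMap hF

/-- A triangular homogeneous system with nonzero diagonal coefficients is an endomorphism. -/
def Endo.ofTriangular (hd : 2 ≤ d) (g : Fin (N + 1) → MvPolynomial (Fin (N + 1)) K)
    (hom : ∀ i, (g i).IsHomogeneous d) (hg : IsTriangular g)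
    (ha : ∀ i, (g i).coeff (Finsupp.single i d) ≠ 0) : Endo K N d where
  poly := g
  homogeneous := hom
  eq_zero_of_eval v hv := by
    funext i
    induction i using WellFoundedLT.induction with
    | ind i ih =>
      have h := hg.dependsOn i (x := v) (y := Function.update (0 : Fin (N + 1) → K) i (v i))
        fun l hl => by
          rcases eq_or_lt_of_le (Set.mem_Iic.mp hl) with rfl | hl
          · rw [Function.update_self]
          · rw [Function.update_of_ne hl.ne, ih l hl]
      simp only at h
      rw [hv, ← eval_slice, slice_zero_of_isHomogeneous (hom i)] at h
      simp only [eval_mul, eval_C, eval_pow, eval_X] at h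
      exact pow_eq_zero_iff (by omega) |>.mp ((mul_eq_zero.mp h.symm).resolve_left (ha i))

variable (K N) in
/-- The power map `[x_0 ^ d, …, x_N ^ d]`. -/
noncomputable def powerEndo (hd : 2 ≤ d) : Endo K N d :=
  Endo.ofTriangular hd (fun i => MvPolynomial.X i ^ d)
    (fun i => by simpa using (MvPolynomial.isHomogeneous_X K i).pow d) isTriangular_X_pow
    fun i => by simp [MvPolynomial.X_pow_eq_monomial]

theorem multipliers_powerEndo (hd : 2 ≤ d) :
    multipliers (powerEndo K N hd).poly ⊆ {0, (d : K)} := by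
  rintro _ ⟨v, hv, i, rfl⟩
  have h : v i ^ d = v i := by simpa [powerEndo, Endo.ofTriangular] using hv i
  have h2 : MvPolynomial.eval v (MvPolynomial.pderiv i ((powerEndo K N hd).poly i)) =
      d * v i ^ (d - 1) := by
    simp [powerEndo, Endo.ofTriangular]
  rw [h2]
  by_cases h0 : v i = 0
  · left
    rw [h0, zero_pow (by omega), mul_zero]
  · right
    rw [← Nat.sub_add_cancel (by omega : 1 ≤ d), pow_succ] at h
    rw [Set.mem_singleton_iff, mul_right_cancel₀ h0 (h.trans (one_mul _).symm), mul_one]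

/-- The terms are `-1` and `1/(d - 1)`. If `a` of the first kind cancel `b` of the second, then `b =
(d - 1) * a`, and there are `d * a` terms in all, too many unless `a = 0`. -/
theorem noVanishingSum_zero_degree [CharZero K] (hd : 2 ≤ d) : NoVanishingSum d {0, (d : K)} := by
  intro M hM hcard hMS hsum
  obtain ⟨c, rfl⟩ : ∃ c, d = c + 1 := ⟨d - 1, by omega⟩
  have hc : (c : K) ≠ 0 := by exact_mod_cast (by omega : c ≠ 0)
  obtain ⟨a, b, hab, h⟩ : ∃ a b : ℕ, a + b = M.card ∧
      (c : K) * (M.map fun s => (s - 1)⁻¹).sum = b - c * a := by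
    clear hM hcard hsum
    induction M using Multiset.induction_on with
    | empty => exact ⟨0, 0, by simp⟩
    | cons s M ih =>
      obtain ⟨a, b, hab, h⟩ := ih fun t ht => hMS t (Multiset.mem_cons_of_mem ht)
      rw [Multiset.map_cons, Multiset.sum_cons, Multiset.card_cons, ← hab, mul_add, h]
      rcases hMS s (Multiset.mem_cons_self s M) with rfl | hs
      · refine ⟨a + 1, b, by omega, ?_⟩
        rw [zero_sub, inv_neg, inv_one]
        push_cast
        ring
      · refine ⟨a, b + 1, by omega, ?_⟩
        rw [Set.mem_singleton_iff.mp hs]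
        push_cast
        rw [add_sub_cancel_right, mul_inv_cancel₀ hc]
        ring
  rw [hsum, mul_zero, eq_comm, sub_eq_zero] at h
  have h' : b = c * a := by exact_mod_cast h
  have hpos : 0 < M.card := Multiset.card_pos.mpr hM
  rcases Nat.eq_zero_or_pos a with rfl | ha
  · simp at h'
    omega
  · have := Nat.le_mul_of_pos_right c ha
    omega

theorem powerEndo_mem (hd : 2 ≤ d) : powerEndo K N hd ∈ triangularEndos K N d := by
  refine ⟨fun i => MvPolynomial.X i ^ d, isTriangular_X_pow, fun i => ?_, ?_⟩
  · simp
  · exact funext fun i => (homogenizeMap_X_pow i).symm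

end Homogenize

/-! ### Density of the good triangular maps. -/

section Density

variable {K : Type*} [Field K] {N d : ℕ}

theorem exists_basicOpen_subset {o : Set (Endo K N d)} (ho : IsOpen o) {f : Endo K N d}
    (hf : f ∈ o) : ∃ Φ : MvPolynomial (Fin (N + 1) × (Fin (N + 1) →₀ ℕ)) K,
      MvPolynomial.eval (fun p => (f.poly p.1).coeff p.2) Φ ≠ 0 ∧
      ∀ g : Endo K N d, MvPolynomial.eval (fun p => (g.poly p.1).coeff p.2) Φ ≠ 0 → g ∈ o := by
  have hbasis := TopologicalSpace.isTopologicalBasis_of_subbasis_of_inter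
    (t := Endo.zariskiTopology (K := K) (N := N) (d := d)) rfl (by
      rintro _ ⟨Φ, rfl⟩ _ ⟨Ψ, rfl⟩
      refine ⟨Φ * Ψ, ?_⟩
      ext g
      simp [map_mul])
  obtain ⟨s, hs, hfs, hso⟩ := hbasis.exists_subset_of_mem_open hf ho
  rcases hs with rfl | ⟨Φ, rfl⟩
  · exact ⟨1, by simp, fun g _ => hso (Set.mem_univ g)⟩
  · exact ⟨Φ, hfs, fun g hg => hso hg⟩

theorem exists_polynomial_on_line {σ : Type*} (x y : σ → K) (Φ : MvPolynomial σ K) :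
    ∃ p : K[X], ∀ t, p.eval t = MvPolynomial.eval (fun s => (1 - t) * x s + t * y s) Φ := by
  refine ⟨MvPolynomial.aeval (fun s => (1 - X) * C (x s) + X * C (y s)) Φ, fun t => ?_⟩
  induction Φ using MvPolynomial.induction_on with
  | C a => simp
  | add p q hp hq => rw [map_add, map_add, Polynomial.eval_add, hp, hq]
  | mul_X p l hp => rw [map_mul, map_mul, Polynomial.eval_mul, hp]; simp [mul_comm t]

/-- On the line from `f` to the power map, being near `f` is a nonempty open condition at `t = 0`
and lying in `U` is one at `t = 1`. The line is infinite, so both hold at a common parameter. -/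
theorem subset_closure_inter_triangularEndos [IsAlgClosed K] (hd : 2 ≤ d) {U : Set (Endo K N d)}
    (hU : IsOpen U) (h₀ : powerEndo K N hd ∈ U) :
    triangularEndos K N d ⊆ closure (U ∩ triangularEndos K N d) := by
  intro f hf
  rw [mem_closure_iff]
  intro o ho hfo
  obtain ⟨Φ, hΦf, hΦ⟩ := exists_basicOpen_subset ho hfo
  obtain ⟨Ψ, hΨf, hΨ⟩ := exists_basicOpen_subset hU h₀
  obtain ⟨p, hp⟩ := exists_polynomial_on_line (fun x => (f.poly x.1).coeff x.2)
    (fun x => ((powerEndo K N hd).poly x.1).coeff x.2) Φ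
  obtain ⟨q, hq⟩ := exists_polynomial_on_line (fun x => (f.poly x.1).coeff x.2)
    (fun x => ((powerEndo K N hd).poly x.1).coeff x.2) Ψ
  have hft := isTriangular_of_mem_triangularEndos hf
  have ha := (Endo.isTriSystem hd hft).coeff_ne_zero
  -- The last factors are the diagonal coefficients along the line; their nonvanishing makes the
  -- intermediate tuple an endomorphism.
  have hne : p * q * ∏ i, ((1 - X) * C ((f.poly i).coeff (Finsupp.single i d)) + X) ≠ 0 := by
    refine mul_ne_zero (mul_ne_zero ?_ ?_) (Finset.prod_ne_zero_iff.mpr fun i _ => ?_)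
    · intro h
      apply hΦf
      simpa [h] using (hp 0).symm
    · intro h
      apply hΨf
      simpa [h] using (hq 1).symm
    · intro h
      apply ha i
      simpa using congrArg (Polynomial.eval 0) h
  obtain ⟨t, ht⟩ : ∃ t, (p * q * ∏ i, ((1 - X) * C ((f.poly i).coeff (Finsupp.single i d)) +
      X)).eval t ≠ 0 := by
    by_contra! hcon
    exact hne (Polynomial.funext fun t => by rw [hcon t, Polynomial.eval_zero])
  rw [Polynomial.eval_mul, Polynomial.eval_mul, Polynomial.eval_prod] at ht
  have htp := left_ne_zero_of_mul (left_ne_zero_of_mul ht)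
  have htq := right_ne_zero_of_mul (left_ne_zero_of_mul ht)
  have hta := Finset.prod_ne_zero_iff.mp (right_ne_zero_of_mul ht)
  have hpow : ∀ i, (powerEndo K N hd).poly i = MvPolynomial.X i ^ d := fun _ => rfl
  let g : Endo K N d := Endo.ofTriangular hd
    (fun i => (1 - t) • f.poly i + t • (powerEndo K N hd).poly i)
    (fun i => by
      rw [MvPolynomial.smul_eq_C_mul, MvPolynomial.smul_eq_C_mul]
      refine MvPolynomial.IsHomogeneous.add ?_ ?_
      · simpa using (MvPolynomial.isHomogeneous_C _ (1 - t)).mul (f.homogeneous i)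
      · simpa using (MvPolynomial.isHomogeneous_C _ t).mul ((powerEndo K N hd).homogeneous i))
    (isTriangular_add_smul _ _ hft isTriangular_X_pow)
    (fun i => by
      have := hta i (Finset.mem_univ i)
      rw [hpow, MvPolynomial.X_pow_eq_monomial]
      simpa using this)
  have hcoeff : (fun x : Fin (N + 1) × (Fin (N + 1) →₀ ℕ) => (g.poly x.1).coeff x.2) = fun x =>
      (1 - t) * (f.poly x.1).coeff x.2 + t * ((powerEndo K N hd).poly x.1).coeff x.2 := by
    funext x
    simp [g, Endo.ofTriangular]
  refine ⟨g, hΦ g ?_, hΨ g ?_, ?_⟩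
  · rwa [hcoeff, ← hp]
  · rwa [hcoeff, ← hq]
  · obtain ⟨F, hF, hFd, hfF⟩ := hf
    refine ⟨fun i => (1 - t) • F i + t • MvPolynomial.X i ^ d,
      isTriangular_add_smul _ _ hF isTriangular_X_pow, fun i => ?_, funext fun i => ?_⟩
    · refine (MvPolynomial.totalDegree_add _ _).trans (max_le ?_ ?_)
      · exact (MvPolynomial.totalDegree_smul_le _ _).trans (hFd i)
      · exact (MvPolynomial.totalDegree_smul_le _ _).trans (by simp)
    · rw [homogenizeMap_add_smul _ _ (sub_add_cancel 1 t), homogenizeMap_X_pow, ← hfF]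
      rfl

end Density

/-! ### Conclusion. -/

theorem IsTriSystem.finite_multipliers {K : Type*} [Field K] {n d : ℕ} (hd : 2 ≤ d)
    {g : Fin n → MvPolynomial (Fin n) K} (hg : IsTriSystem d g) : (multipliers g).Finite := by
  refine ((hg.finite_fixedVectors hd).biUnion fun v _ => Set.finite_range fun i =>
    MvPolynomial.eval v (MvPolynomial.pderiv i (g i))).subset ?_
  rintro _ ⟨v, hv, i, rfl⟩
  exact Set.mem_biUnion hv ⟨i, rfl⟩

end ProjDyn

theorem mainTheorem7 (K : Type*) [Field K] [IsAlgClosed K] [CharZero K] (N d : ℕ) (hd : 2 ≤ d) :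
    ∃ U : Set (ProjDyn.Endo K N d), IsOpen U ∧
      ProjDyn.triangularEndos K N d ⊆ closure (U ∩ ProjDyn.triangularEndos K N d) ∧
      ∀ f ∈ U ∩ ProjDyn.triangularEndos K N d,
        {x : ProjDyn.Moduli K N d | ∃ g ∈ ProjDyn.triangularEndos K N d,
          g.toModuli = x ∧ g.multiplierMap = f.multiplierMap}.Finite := by
  obtain ⟨U, hU, h₀, hUf⟩ := ProjDyn.exists_isOpen_noVanishingSum hd
    (ProjDyn.isTriangular_of_mem_triangularEndos (ProjDyn.powerEndo_mem (K := K) (N := N) hd))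
    fun M hM hcard hMS => ProjDyn.noVanishingSum_zero_degree hd M hM hcard
      fun s hs => ProjDyn.multipliers_powerEndo hd (hMS s hs)
  refine ⟨U, hU, ProjDyn.subset_closure_inter_triangularEndos hd hU h₀, fun f hf => ?_⟩
  have hft := ProjDyn.isTriangular_of_mem_triangularEndos hf.2
  have hfin := ProjDyn.finite_normalized_systems (n := N + 1) hd
    ((ProjDyn.Endo.isTriSystem hd hft).finite_multipliers hd) (hUf f hf.1 hft)
  have hinj : Function.Injective (ProjDyn.Endo.poly (K := K) (N := N) (d := d)) :=
    fun g g' h => ProjDyn.Endo.ext h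
  -- Every class in the fibre contains a normalized system with multipliers among those of `f`. This
  -- representative need not be shown to lie in `triangularEndos`.
  refine ((hfin.preimage hinj.injOn).image ProjDyn.Endo.toModuli).subset ?_
  rintro x ⟨g, hg, rfl, hgf⟩
  have hgt := ProjDyn.isTriangular_of_mem_triangularEndos hg
  obtain ⟨g', hconj, h1, h2, h3⟩ :=
    ProjDyn.exists_isConj_isNormalized hd g (ProjDyn.Endo.isTriSystem hd hgt)
  exact ⟨g', ⟨h1, h2, h3.trans (ProjDyn.Endo.multipliers_subset hd hft hgt hgf)⟩,
    (Quotient.sound (s := ProjDyn.Endo.conjSetoid K N d) hconj).symm⟩
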